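/- Let $\kappa$ be an uncountable cardinal with $\kappa^{<\kappa}=\kappa$. Give $2^\kappa$ the topology generated by the sets $N_p=\{\eta\in 2^\kappa:\eta\restriction\alpha=p\}$ ($\alpha<\kappa$, $p\in 2^\alpha$), call a subset of a topological space Borel if it belongs to the closure of the topology under complements and under unions and intersections of length at most $\kappa$, and call a function Borel if inverse images of open sets are Borel. For equivalence relations $E,E'$ on spaces $X,X'$ write $E\le_B E'$ if there is a Borel function $f:X\to X'$ with $x\,E\,y\iff f(x)\,E'\,f(y)$, and $E<_B E'$ if $E\le_B E'$ and $E'\not\le_B E$. Let $E_0$ be the relation on $2^\kappa$ with $\eta\,E_0\,\xi$ iff $\{\alpha<\kappa:\eta(\alpha)\ne\xi(\alpha)\}$ is bounded in $\kappa$. For a set $S\subseteq\kappa$ of limit ordinals let $\eta\,E_S\,\xi$ iff $\eta\,E_0\,\xi$ and for each $\alpha\in S$ there is $\beta<\alpha$ such that either $\eta(\gamma)=\xi(\gamma)$ for all $\gamma\in(\beta,\alpha)$ or $\eta(\gamma)\neq\xi(\gamma)$ for all $\gamma\in(\beta,\alpha)$. For $0<j<\kappa^+$, the disjoint union $\bigoplus_{i<j}E_{S_i}$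 is the equivalence relation on the topological disjoint union of $j$ copies of $2^\kappa$ that relates $\eta$ and $\xi$ iff they lie in the same copy, say the $i$-th, and $\eta\,E_{S_i}\,\xi$. Then there are stationary sets $S_i\subseteq\kappa$, $i<\kappa^+$, consisting of ordinals of cofinality $\omega$, with $S_i\setminus S_j$ stationary whenever $i\ne j$, and there are equivalence relations $R_i$, $i<\kappa^+$, on $2^\kappa$ that are Borel subsets of $2^\kappa\times 2^\kappa$, such that: 1. for each $i<\kappa^+$, $R_i$ is Borel isomorphic to $\bigoplus_{j<1+i}E_{S_j}$, i.e. some bijection between the underlying spaces that is Borel in both directions carries one relation to the other; 2. for all $i,j<\kappa^+$: $i<j\iff R_i<_B R_j$; 3. for all $i<\kappa^+$: $R_i\le_B E_0$ and $E_0\not\le_B R_i$. -/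

import Mathlib

open Cardinal Ordinal

universe u v w

namespace GenCantor

/-- The set of ordinals below the cardinal `κ`, as a type. -/
abbrev Below (κ : Cardinal.{u}) : Type (u + 1) := Set.Iio κ.ord

/-- The generalized Cantor space `2^κ`: all functions from `κ` to `{0, 1}`.
It is a definition (not an abbreviation), so that it does not carry the product topology. -/
def Cantor (κ : Cardinal.{u}) : Type (u + 1) := Below κ → Bool

/-- The basic open set of all `η` that agree with `p` below `α`. (Every function from `α` to
`{0, 1}` is the restriction of some `p` in `2^κ`.) -/
def basicOpen (κ : Cardinal.{u}) (α : Below κ) (p : Cantor κ) : Set (Cantor κ) :=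
  {η | ∀ β : Below κ, β < α → η β = p β}

/-- The bounded topology on `2^κ`, generated by the basic open sets. -/
instance instTopologicalSpaceCantor (κ : Cardinal.{u}) : TopologicalSpace (Cantor κ) :=
  TopologicalSpace.generateFrom {U | ∃ (α : Below κ) (p : Cantor κ), U = basicOpen κ α p}

/-- The Borel sets of the generalized theory: the closure of the open sets under complements and
under unions and intersections of length at most `κ`. -/
inductive IsKBorel (κ : Cardinal.{u}) {X : Type v} [TopologicalSpace X] : Set X → Prop
  | of_isOpen (U : Set X) (hU : IsOpen U) : IsKBorel κ U
  | compl (A : Set X) (hA : IsKBorel κ A) : IsKBorel κ Aᶜ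
  | iUnion (o : Ordinal.{u}) (ho : o ≤ κ.ord) (A : Set.Iio o → Set X)
      (hA : ∀ i, IsKBorel κ (A i)) : IsKBorel κ (⋃ i, A i)
  | iInter (o : Ordinal.{u}) (ho : o ≤ κ.ord) (A : Set.Iio o → Set X)
      (hA : ∀ i, IsKBorel κ (A i)) : IsKBorel κ (⋂ i, A i)

/-- Borel functions: inverse images of open sets are Borel. -/
def IsKBorelMap (κ : Cardinal.{u}) {X : Type v} {Y : Type w} [TopologicalSpace X]
    [TopologicalSpace Y] (f : X → Y) : Prop :=
  ∀ U : Set Y, IsOpen U → IsKBorel κ (f ⁻¹' U)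

/-- `E` is Borel reducible to `E'`. -/
def BorelReducible (κ : Cardinal.{u}) {X : Type v} {Y : Type w} [TopologicalSpace X]
    [TopologicalSpace Y] (E : X → X → Prop) (E' : Y → Y → Prop) : Prop :=
  ∃ f : X → Y, IsKBorelMap κ f ∧ ∀ x y, E x y ↔ E' (f x) (f y)

/-- `E` is strictly below `E'` in the order of Borel reducibility. -/
def StrictlyBorelReducible (κ : Cardinal.{u}) {X : Type v} {Y : Type w} [TopologicalSpace X]
    [TopologicalSpace Y] (E : X → X → Prop) (E' : Y → Y → Prop) : Prop :=
  BorelReducible κ E E' ∧ ¬ BorelReducible κ E' E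

/-- `E` and `E'` are Borel isomorphic: a bijection of the underlying spaces that is Borel in both
directions carries `E` to `E'`. -/
def BorelIsomorphic (κ : Cardinal.{u}) {X : Type v} {Y : Type w} [TopologicalSpace X]
    [TopologicalSpace Y] (E : X → X → Prop) (E' : Y → Y → Prop) : Prop :=
  ∃ φ : X ≃ Y, IsKBorelMap κ φ ∧ IsKBorelMap κ φ.symm ∧ ∀ x y, E x y ↔ E' (φ x) (φ y)

/-- Borel equivalence relations on `2^κ`: equivalence relations that are Borel subsets of
`2^κ × 2^κ`. -/
structure IsBorelEquivalence (κ : Cardinal.{u}) (E : Cantor κ → Cantor κ → Prop) : Prop where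
  equivalence : Equivalence E
  borel : IsKBorel κ {x : Cantor κ × Cantor κ | E x.1 x.2}

/-- `E₀`: equality modulo a bounded subset of `κ`. -/
def E0 (κ : Cardinal.{u}) (η ξ : Cantor κ) : Prop :=
  ∃ β : Below κ, ∀ α : Below κ, η α ≠ ξ α → α < β

/-- The symmetric difference of two elements of `2^κ`. -/
def symmDiffFun (κ : Cardinal.{u}) (η ξ : Cantor κ) : Cantor κ := fun α => xor (η α) (ξ α)

/-- `E_S^*`: at each `α` in `S`, the symmetric difference of `η` and `ξ` is constant on some
interval `(β, α)` with `β < α`. -/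
def EStar (κ : Cardinal.{u}) (S : Set (Below κ)) (η ξ : Cantor κ) : Prop :=
  ∀ α ∈ S, ∃ β < α, ∃ b : Bool, ∀ γ ∈ Set.Ioo β α, symmDiffFun κ η ξ γ = b

/-- `E_S = E_S^* ∩ E₀`. -/
def ES (κ : Cardinal.{u}) (S : Set (Below κ)) (η ξ : Cantor κ) : Prop :=
  EStar κ S η ξ ∧ E0 κ η ξ

/-- The disjoint union `⊕_{i < j} E_i`, an equivalence relation on the disjoint union of `j` copies
of `2^κ` (with the topology of the disjoint union). -/
def directSum (κ : Cardinal.{u}) (j : Ordinal.{u})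
    (E : Ordinal.{u} → Cantor κ → Cantor κ → Prop)
    (x y : Σ _ : Set.Iio j, Cantor κ) : Prop :=
  x.1 = y.1 ∧ E x.1 x.2 y.2

/-- The set of ordinals below `κ` of cofinality `ω`. -/
def cofOmega (κ : Cardinal.{u}) : Set (Below κ) := {α | Ordinal.cof (α : Ordinal.{u}) = ℵ₀}

end GenCantor

namespace GenCantor

/-! ### Regularity, bounded sets and cofinality `ω` -/

variable {κ : Cardinal.{u}}

/-! Everything strict comes from one principle, `not_borelReducible_directSum`: if the index set has
size at most `κ` and `S k \ S'` is stationary for every `k`, then `E_{S'}` does not reduce to the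
sum of the `E_{S k}`. For `i < j`, taking `S' = S (1 + i)`, a summand of `R j`, gives that `R j`
does not reduce to `R i`; taking `S' = ∅`, where `E_∅ = E₀`, gives that `E₀` reduces to no `R i`.

The principle is a category argument. Borel sets are relatively clopen in comeager sets
(`IsKBorel.exists_decidedOn`), so on a comeager set a Borel reduction has locally constant
coordinates, and on a basic open part it takes values in a single copy `k`. Pick `α` in `S k \ S'`
closed under the construction, and build an `ω`-chain of pairs of bounded approximations with
lengths tending to `α`. Each step prolongs the pair with constant difference, alternately 0 and 1,
and forces the same bit into the difference of the images at a new coordinate. Finally make the pair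
equal from `α` on. It is `E_{S'}`-equivalent, since the only possible violation is at `α`, which is
not in `S'`; but the images differ and agree cofinally often below `α`, which is in `S k`.

The sets `S i` are unions of subfamilies of `κ` many disjoint stationary sets, indexed by pairwise
incomparable sets of indices. A sum reduces to `E₀` by recording, at each `α`, the copy, the value
at `α` and the class of the part below `α`; `κ^{<κ} = κ` keeps the number of classes at most `κ`. A
Schröder–Bernstein argument moves the sums to `2^κ`. -/

theorem isRegular_of_powerlt (hκ : ℵ₀ ≤ κ) (hpow : κ ^< κ = κ) : κ.IsRegular := by
  refine ⟨hκ, ?_⟩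
  by_contra! h
  -- König's inequality: `κ < κ ^ cf κ`, while `cf κ < κ` would give `κ ^ cf κ ≤ κ ^< κ = κ`.
  exact (lt_power_cof_ord hκ).not_ge ((le_powerlt _ h).trans hpow.le)

theorem mk_below (κ : Cardinal.{u}) : #(Below κ) = lift.{u + 1} κ := by
  simp [Below, Cardinal.mk_Iio_ordinal]

theorem mk_Iio_below (α : Below κ) : #(Set.Iio α) < lift.{u + 1} κ := by
  have h : #(Set.Iio α) ≤ #(Set.Iio (α : Ordinal.{u})) :=
    Cardinal.mk_le_of_injective (f := fun x => ⟨x.1.1, x.2⟩) (by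
      intro x y hxy
      exact Subtype.ext (Subtype.ext (Subtype.mk.inj hxy)))
  refine h.trans_lt ?_
  rw [Cardinal.mk_Iio_ordinal, Cardinal.lift_lt]
  exact Cardinal.lt_ord.1 α.2

theorem cof_below (hr : κ.IsRegular) : Order.cof (Below κ) = lift.{u + 1} κ := by
  rw [Ordinal.cof_Iio, ← Ordinal.lift_cof, hr.cof_ord]

theorem exists_forall_lt (hr : κ.IsRegular) {ι : Type (u + 1)} (f : ι → Below κ)
    (h : #ι < lift.{u + 1} κ) : ∃ β, ∀ i, f i < β := by
  have : ¬ IsCofinal (Set.range f) := fun hc =>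
    ((Order.cof_le hc).trans Cardinal.mk_range_le).not_gt (by rwa [cof_below hr])
  obtain ⟨β, hβ⟩ := not_isCofinal_iff.1 this
  exact ⟨β, fun i => hβ _ ⟨i, rfl⟩⟩

theorem exists_forall_lt_of_mk_lt (hr : κ.IsRegular) (A : Set (Below κ))
    (h : #A < lift.{u + 1} κ) : ∃ β, ∀ a ∈ A, a < β := by
  obtain ⟨β, hβ⟩ := exists_forall_lt hr (fun a : A => a.1) h
  exact ⟨β, fun a ha => hβ ⟨a, ha⟩⟩

theorem exists_forall_Iio_lt (hr : κ.IsRegular) (α : Below κ) (f : Below κ → Below κ) :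
    ∃ β, ∀ a < α, f a < β := by
  obtain ⟨β, hβ⟩ := exists_forall_lt hr (fun a : Set.Iio α => f a.1) (mk_Iio_below α)
  exact ⟨β, fun a ha => hβ ⟨a, ha⟩⟩

theorem noMaxOrder_below (hr : κ.IsRegular) : NoMaxOrder (Below κ) := by
  refine ⟨fun a => ?_⟩
  obtain ⟨β, hβ⟩ := exists_forall_lt_of_mk_lt hr {a} (by
    rw [Cardinal.mk_singleton]
    simpa using Cardinal.one_lt_aleph0.trans_le hr.aleph0_le)
  exact ⟨β, hβ a rfl⟩

theorem nonempty_below (hr : κ.IsRegular) : Nonempty (Below κ) :=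
  ⟨⟨0, hr.ord_pos⟩⟩

theorem mk_Iic_below (hr : κ.IsRegular) (α : Below κ) : #(Set.Iic α) < lift.{u + 1} κ := by
  have := noMaxOrder_below hr
  obtain ⟨β, hβ⟩ := exists_gt α
  exact (Cardinal.mk_le_mk_of_subset fun x hx => lt_of_le_of_lt hx hβ).trans_lt (mk_Iio_below β)

theorem exists_isLUB {A : Set (Below κ)} (h : BddAbove A) : ∃ x, IsLUB A x := by
  obtain ⟨x, hx, hmin⟩ := WellFounded.has_min (wellFounded_lt (α := Below κ)) (upperBounds A) h
  exact ⟨x, hx, fun y hy => not_lt.1 (hmin y hy)⟩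

theorem exists_isLUB_seq (hκ : ℵ₀ < κ) (hr : κ.IsRegular) (f : ℕ → Below κ) :
    ∃ x, IsLUB (Set.range f) x := by
  obtain ⟨β, hβ⟩ := exists_forall_lt_of_mk_lt hr (Set.range f) (by
    refine (Set.countable_range f).le_aleph0.trans_lt ?_
    simpa using hκ)
  exact exists_isLUB ⟨β, fun x hx => (hβ x hx).le⟩

theorem mem_cofOmega_of_isLUB {f : ℕ → Below κ} (hf : StrictMono f) {x : Below κ}
    (hx : IsLUB (Set.range f) x) : x ∈ cofOmega κ := by
  have hf' : StrictMono (fun n => (f n : Ordinal.{u})) := fun _ _ h => hf h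
  have hle : ∀ n, (f n : Ordinal.{u}) ≤ x := fun n => hx.1 ⟨n, rfl⟩
  have hsup : (⨆ n, (f n : Ordinal.{u})) = x := by
    refine le_antisymm (Ordinal.iSup_le hle) ?_
    have hs : (⨆ n, (f n : Ordinal.{u})) < κ.ord := (Ordinal.iSup_le hle).trans_lt x.2
    have : x ≤ ⟨_, hs⟩ := hx.2 (by
      rintro _ ⟨n, rfl⟩
      exact Ordinal.le_iSup (fun n => (f n : Ordinal.{u})) n)
    exact this
  have h := Ordinal.lift_cof_iSup hf'
  rw [hsup] at h
  simpa [cofOmega] using h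

theorem exists_seq_of_mem_cofOmega {α : Below κ} (hα : α ∈ cofOmega κ) :
    ∃ a : ℕ → Below κ, (∀ n, a n < α) ∧ ∀ β < α, ∃ n, β < a n := by
  have hc : Ordinal.cof (α : Ordinal.{u}) = ℵ₀ := hα
  obtain ⟨s, hs, hcard⟩ := Order.exists_cof_eq (α : Ordinal.{u}).ToType
  rw [Ordinal.cof_toType, hc] at hcard
  obtain ⟨e⟩ : Nonempty (ℕ ≃ s) := by
    have := Cardinal.mk_eq_aleph0 ℕ
    exact Cardinal.lift_mk_eq'.1 (by simp [hcard])
  have hlim : Order.IsSuccLimit (α : Ordinal.{u}) := Ordinal.one_lt_cof_iff.1 (hc ▸ Cardinal.one_lt_aleph0)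
  let t : ℕ → Set.Iio (α : Ordinal.{u}) := fun n => Ordinal.ToType.mk.symm (e n).1
  refine ⟨fun n => ⟨(t n).1, lt_trans (Set.mem_Iio.1 (t n).2) α.2⟩, fun n => (t n).2, fun β hβ => ?_⟩
  -- Cofinality gives only `≤`, so it is applied to the successor of `β`.
  have hβ' : Order.succ (β : Ordinal.{u}) < α := hlim.succ_lt hβ
  obtain ⟨y, hy, hle⟩ := hs (Ordinal.ToType.mk ⟨_, hβ'⟩)
  refine ⟨e.symm ⟨y, hy⟩, ?_⟩
  have h2 : (⟨_, hβ'⟩ : Set.Iio (α : Ordinal.{u})) ≤ Ordinal.ToType.mk.symm y :=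
    (OrderIso.le_symm_apply _).2 hle
  have h3 : (t (e.symm ⟨y, hy⟩)) = Ordinal.ToType.mk.symm y := by simp [t]
  change (β : Ordinal.{u}) < (t (e.symm ⟨y, hy⟩)).1
  rw [h3]
  exact (Order.lt_succ _).trans_le h2

/-! ### Clubs and Fodor's lemma -/

theorem cof_below_ne (hκ : ℵ₀ < κ) (hr : κ.IsRegular) : Order.cof (Below κ) ≠ ℵ₀ := by
  rw [cof_below hr]
  intro h
  rw [Cardinal.lift_eq_aleph0] at h
  exact hκ.ne' h

theorem isClub_Ioi (hr : κ.IsRegular) (β : Below κ) : IsClub (Set.Ioi β) := by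
  have := noMaxOrder_below hr
  refine ⟨fun d hd ⟨x, hx⟩ _ a ha => lt_of_lt_of_le (hd hx) (ha.1 hx), fun a => ?_⟩
  obtain ⟨c, hc⟩ := exists_gt (max a β)
  exact ⟨c, (le_max_right a β).trans_lt hc, (le_max_left a β).trans hc.le⟩

theorem isClub_diagInter (hκ : ℵ₀ < κ) (hr : κ.IsRegular) {C : Below κ → Set (Below κ)}
    (hC : ∀ β, IsClub (C β)) : IsClub {α | ∀ β < α, α ∈ C β} := by
  have := noMaxOrder_below hr
  constructor
  · intro d hd _ _ a ha β hβ
    obtain ⟨y, hy, hβy⟩ := (lt_isLUB_iff ha).1 hβ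
    refine (hC β).isLUB_mem (t := {z ∈ d | y ≤ z}) ?_ ⟨y, hy, le_rfl⟩ ?_
    · rintro z ⟨hz, hyz⟩
      exact hd hz β (hβy.trans_le hyz)
    · refine ⟨fun z hz => ha.1 hz.1, fun b hb => ha.2 fun z hz => ?_⟩
      rcases le_total y z with h | h
      · exact hb ⟨hz, h⟩
      · exact h.trans (hb ⟨hy, le_rfl⟩)
  · intro a
    have hclub : ∀ x : Below κ, IsClub (⋂ β : Set.Iic x, C β.1) := fun x =>
      IsClub.iInter (cof_below_ne hκ hr) (by
        rw [cof_below hr]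
        simpa using mk_Iic_below hr x) fun β => hC β.1
    have hstep : ∀ x : Below κ, ∃ y, x < y ∧ ∀ β ≤ x, y ∈ C β := by
      intro x
      obtain ⟨x', hx'⟩ := exists_gt x
      obtain ⟨y, hy, hxy⟩ := (hclub x).isCofinal x'
      exact ⟨y, hx'.trans_le hxy, fun β hβ => Set.mem_iInter.1 hy ⟨β, hβ⟩⟩
    choose g hg hgC using hstep
    -- For each `β` below the supremum of this sequence, a tail of it lies in `C β`, so the supremum
    -- does too.
    let s : ℕ → Below κ := fun n => g^[n] a
    have hs : ∀ n, s (n + 1) = g (s n) := fun n => Function.iterate_succ_apply' g n a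
    have hmono : StrictMono s := strictMono_nat_of_lt_succ fun n => by rw [hs]; exact hg _
    obtain ⟨x, hx⟩ := exists_isLUB_seq hκ hr s
    refine ⟨x, fun β hβ => ?_, hx.1 ⟨0, rfl⟩⟩
    obtain ⟨_, ⟨n, rfl⟩, hn⟩ := (lt_isLUB_iff hx).1 hβ
    refine (hC β).isLUB_mem (t := Set.range fun m => s (n + m + 1)) ?_ (Set.range_nonempty _) ?_
    · rintro _ ⟨m, rfl⟩
      change s (n + m + 1) ∈ _
      rw [hs]
      exact hgC _ _ (hn.le.trans (hmono.monotone (by omega)))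
    · refine ⟨?_, fun b hb => hx.2 ?_⟩
      · rintro _ ⟨m, rfl⟩
        exact hx.1 ⟨_, rfl⟩
      · rintro _ ⟨m, rfl⟩
        exact (hmono.monotone (by omega)).trans (hb ⟨m, rfl⟩)

/-- Fodor's pressing down lemma. -/
theorem exists_isStationary_fiber (hκ : ℵ₀ < κ) (hr : κ.IsRegular) {S : Set (Below κ)}
    (hS : IsStationary S) (f : Below κ → Below κ) (hf : ∀ α ∈ S, f α < α) :
    ∃ γ, IsStationary {α ∈ S | f α = γ} := by
  by_contra! h
  simp only [not_isStationary_iff] at h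
  choose C hC hdisj using h
  obtain ⟨α, hαS, hα⟩ := hS (isClub_diagInter hκ hr hC)
  exact Set.disjoint_left.1 (hdisj (f α)) ⟨hαS, rfl⟩ (hα _ (hf α hαS))

theorem isStationary_cofOmega (hκ : ℵ₀ < κ) (hr : κ.IsRegular) : IsStationary (cofOmega κ) := by
  have := noMaxOrder_below hr
  intro C hC
  have hstep : ∀ x : Below κ, ∃ y ∈ C, x < y := by
    intro x
    obtain ⟨x', hx'⟩ := exists_gt x
    obtain ⟨y, hy, hxy⟩ := hC.isCofinal x'
    exact ⟨y, hy, hx'.trans_le hxy⟩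
  choose g hgC hg using hstep
  obtain ⟨a⟩ := nonempty_below hr
  let s : ℕ → Below κ := fun n => g^[n + 1] a
  have hs : ∀ n, s (n + 1) = g (s n) := fun n => Function.iterate_succ_apply' g (n + 1) a
  have hmono : StrictMono s := strictMono_nat_of_lt_succ fun n => by rw [hs]; exact hg _
  obtain ⟨x, hx⟩ := exists_isLUB_seq hκ hr s
  refine ⟨x, mem_cofOmega_of_isLUB hmono hx, hC.isLUB_mem ?_ (Set.range_nonempty s) hx⟩
  rintro _ ⟨n, rfl⟩
  have : s n = g (g^[n] a) := Function.iterate_succ_apply' g n a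
  rw [this]
  exact hgC _

/-- The set of ordinals of cofinality `ω` contains `κ` many pairwise disjoint stationary sets. -/
theorem exists_disjoint_isStationary (hκ : ℵ₀ < κ) (hr : κ.IsRegular) :
    ∃ T : Below κ → Set (Below κ), (∀ γ, T γ ⊆ cofOmega κ) ∧ (∀ γ, IsStationary (T γ)) ∧
      ∀ γ δ, γ ≠ δ → Disjoint (T γ) (T δ) := by
  classical
  have := noMaxOrder_below hr
  have hseq : ∀ α : Below κ, ∃ a : ℕ → Below κ, α ∈ cofOmega κ →
      (∀ n, a n < α) ∧ ∀ β < α, ∃ n, β < a n := by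
    intro α
    by_cases h : α ∈ cofOmega κ
    · obtain ⟨a, ha⟩ := exists_seq_of_mem_cofOmega h
      exact ⟨a, fun _ => ha⟩
    · exact ⟨fun _ => α, fun h' => absurd h' h⟩
  choose a ha using hseq
  -- One position `n` in the ladders works for all `η`: given counterexamples `η n` with supremum
  -- `x`, the points above `x` would be covered by countably many nonstationary sets.
  obtain ⟨n, hn⟩ : ∃ n, ∀ η, IsStationary {α ∈ cofOmega κ | η ≤ a α n} := by
    by_contra! h
    choose η hη using h
    obtain ⟨x, hx⟩ := exists_isLUB_seq hκ hr η
    have h1 : IsStationary {α ∈ cofOmega κ | x < α} := by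
      intro t ht
      obtain ⟨y, hy, hyt, hxy⟩ :=
        isStationary_cofOmega hκ hr (ht.inter (cof_below_ne hκ hr) (isClub_Ioi hr x))
      exact ⟨y, ⟨hy, hxy⟩, hyt⟩
    have h2 : {α ∈ cofOmega κ | x < α} ⊆ ⋃ n, {α ∈ cofOmega κ | η n ≤ a α n} := by
      rintro α ⟨hα, hxα⟩
      obtain ⟨n, hn⟩ := (ha α hα).2 x hxα
      exact Set.mem_iUnion.2 ⟨n, hα, (hx.1 ⟨n, rfl⟩).trans hn.le⟩
    obtain ⟨n, hn⟩ := (isStationary_iUnion_iff_of_countable (cof_below_ne hκ hr)).1 (h1.mono h2)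
    exact hη n hn
  -- The values with stationary fibre. By Fodor they are unbounded, hence `κ` many, and distinct
  -- fibres are disjoint.
  let Γ : Set (Below κ) := {γ | IsStationary {α ∈ cofOmega κ | a α n = γ}}
  have hΓ : IsCofinal Γ := by
    intro η
    obtain ⟨γ, hγ⟩ := exists_isStationary_fiber hκ hr (hn η) (fun α => a α n)
      fun α hα => (ha α hα.1).1 n
    obtain ⟨α, hα, hαγ⟩ := hγ.nonempty
    refine ⟨γ, hγ.mono ?_, hαγ ▸ hα.2⟩
    rintro β ⟨hβ, rfl⟩
    exact ⟨hβ.1, rfl⟩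
  obtain ⟨e⟩ : Nonempty (Below κ ↪ Γ) := by
    rw [← Cardinal.le_def, mk_below, ← cof_below hr]
    exact Order.cof_le hΓ
  refine ⟨fun γ => {α ∈ cofOmega κ | a α n = e γ}, fun γ α h => h.1, fun γ => (e γ).2, ?_⟩
  intro γ δ hne
  refine Set.disjoint_left.2 ?_
  rintro α ⟨_, h1⟩ ⟨_, h2⟩
  exact hne (e.injective (Subtype.ext (h1.symm.trans h2)))

theorem nonempty_prod_embedding (hr : κ.IsRegular) : Nonempty (Below κ × Below κ ↪ Below κ) := by
  rw [← Cardinal.le_def, Cardinal.mk_prod, mk_below, Cardinal.lift_id]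
  exact (Cardinal.mul_eq_self (by simpa using hr.aleph0_le)).le

theorem nonempty_prod_bool_embedding (hr : κ.IsRegular) : Nonempty (Below κ × Bool ↪ Below κ) := by
  rw [← Cardinal.le_def, Cardinal.mk_prod, mk_below]
  refine (Cardinal.mul_le_max_of_aleph0_le_left (by simpa using hr.aleph0_le)).trans ?_
  refine max_le (by simp) ?_
  have h := hr.aleph0_le
  rw [← Cardinal.lift_le.{u + 1}, Cardinal.lift_aleph0] at h
  refine le_trans ?_ h
  simp

/-- There are `κ⁺` many stationary sets of ordinals of cofinality `ω` whose differences are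
stationary. -/
theorem exists_isStationary_diff_family (hκ : ℵ₀ < κ) (hr : κ.IsRegular) :
    ∃ S : Ordinal.{u} → Set (Below κ),
      (∀ i, S i ⊆ cofOmega κ ∧ IsStationary (S i)) ∧
      ∀ i < (Order.succ κ).ord, ∀ j < (Order.succ κ).ord, i ≠ j → IsStationary (S i \ S j) := by
  classical
  obtain ⟨T, hTω, hT, hdisj⟩ := exists_disjoint_isStationary hκ hr
  obtain ⟨c⟩ := nonempty_prod_bool_embedding hr
  obtain ⟨γ₀⟩ := nonempty_below hr
  obtain ⟨X⟩ : Nonempty (Set.Iio (Order.succ κ).ord ↪ Set (Below κ)) := by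
    rw [← Cardinal.le_def, Cardinal.mk_Iio_ordinal, Cardinal.card_ord, Cardinal.mk_set, mk_below,
      ← Cardinal.lift_two_power, Cardinal.lift_le]
    exact Order.succ_le_of_lt (Cardinal.cantor κ)
  -- Coding `A` together with its complement turns distinct sets into incomparable ones.
  let Y : Set (Below κ) → Set (Below κ) := fun A =>
    {γ | ∃ x, (x ∈ A ∧ γ = c (x, true)) ∨ (x ∉ A ∧ γ = c (x, false))}
  have hY : ∀ A B, A ≠ B → ∃ γ ∈ Y A, γ ∉ Y B := by
    intro A B hAB
    obtain ⟨x, hx⟩ : ∃ x, ¬ (x ∈ A ↔ x ∈ B) := by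
      by_contra! h
      exact hAB (Set.ext h)
    by_cases hA : x ∈ A
    · refine ⟨c (x, true), ⟨x, Or.inl ⟨hA, rfl⟩⟩, ?_⟩
      rintro ⟨y, ⟨hy, h⟩ | ⟨hy, h⟩⟩ <;> have := c.injective h <;> simp at this
      subst this; tauto
    · refine ⟨c (x, false), ⟨x, Or.inr ⟨hA, rfl⟩⟩, ?_⟩
      rintro ⟨y, ⟨hy, h⟩ | ⟨hy, h⟩⟩ <;> have := c.injective h <;> simp at this
      subst this; tauto
  have hYne : ∀ A, (Y A).Nonempty := by
    intro A
    by_cases h : γ₀ ∈ A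
    · exact ⟨_, γ₀, Or.inl ⟨h, rfl⟩⟩
    · exact ⟨_, γ₀, Or.inr ⟨h, rfl⟩⟩
  -- The default `Y ∅` is nonempty, so that `S i` is stationary for every ordinal `i`.
  let Z : Ordinal.{u} → Set (Below κ) := fun i =>
    if h : i < (Order.succ κ).ord then Y (X ⟨i, h⟩) else Y ∅
  have hZne : ∀ i, (Z i).Nonempty := by
    intro i
    simp only [Z]
    split_ifs
    · exact hYne _
    · exact hYne _
  refine ⟨fun i => ⋃ γ ∈ Z i, T γ, fun i => ⟨?_, ?_⟩, fun i hi j hj hij => ?_⟩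
  · exact Set.iUnion₂_subset fun γ _ => hTω γ
  · obtain ⟨γ, hγ⟩ := hZne i
    exact (hT γ).mono (Set.subset_biUnion_of_mem (u := T) hγ)
  · obtain ⟨γ, hγ, hγ'⟩ : ∃ γ ∈ Z i, γ ∉ Z j := by
      simp only [Z, dif_pos hi, dif_pos hj]
      refine hY _ _ fun h => hij ?_
      exact Subtype.mk.inj (X.injective h)
    refine (hT γ).mono fun α hα => ⟨Set.mem_biUnion hγ hα, fun h => ?_⟩
    obtain ⟨δ, hδ, hαδ⟩ := Set.mem_iUnion₂.1 h
    have : γ ≠ δ := fun e => hγ' (e ▸ hδ)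
    exact Set.disjoint_left.1 (hdisj γ δ this) hα hαδ

/-! ### Closure properties of the Borel sets -/

namespace IsKBorel

variable {X : Type v} {Y : Type w} [TopologicalSpace X] [TopologicalSpace Y]

theorem empty : IsKBorel κ (∅ : Set X) := .of_isOpen _ isOpen_empty

theorem univ : IsKBorel κ (Set.univ : Set X) := .of_isOpen _ isOpen_univ

theorem iUnion_of_embedding {ι : Type*} (e : ι ↪ Below κ) {A : ι → Set X}
    (hA : ∀ i, IsKBorel κ (A i)) : IsKBorel κ (⋃ i, A i) := by
  classical
  have h : (⋃ i, A i) = ⋃ b : Below κ, if h : ∃ i, e i = b then A h.choose else ∅ := by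
    ext x
    simp only [Set.mem_iUnion]
    constructor
    · rintro ⟨i, hi⟩
      have h : ∃ j, e j = e i := ⟨i, rfl⟩
      refine ⟨e i, ?_⟩
      rw [dif_pos h, e.injective h.choose_spec]
      exact hi
    · rintro ⟨b, hb⟩
      split_ifs at hb with h
      · exact ⟨_, hb⟩
      · exact hb.elim
  rw [h]
  refine .iUnion κ.ord le_rfl _ fun b => ?_
  split_ifs with h
  · exact hA _
  · exact empty

theorem iInter_of_embedding {ι : Type*} (e : ι ↪ Below κ) {A : ι → Set X}
    (hA : ∀ i, IsKBorel κ (A i)) : IsKBorel κ (⋂ i, A i) := by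
  rw [← compl_compl (⋂ i, A i), Set.compl_iInter]
  exact .compl _ (iUnion_of_embedding e fun i => .compl _ (hA i))

theorem nonempty_embedding_of_countable (hκ : ℵ₀ ≤ κ) (ι : Type*) [Countable ι] :
    Nonempty (ι ↪ Below κ) := by
  rw [← Cardinal.lift_mk_le', mk_below]
  exact (Cardinal.lift_le_aleph0.2 Cardinal.mk_le_aleph0).trans (by simpa using hκ)

theorem iUnion_of_countable (hκ : ℵ₀ ≤ κ) {ι : Type*} [Countable ι] {A : ι → Set X}
    (hA : ∀ i, IsKBorel κ (A i)) : IsKBorel κ (⋃ i, A i) :=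
  (nonempty_embedding_of_countable hκ ι).elim fun e => iUnion_of_embedding e hA

theorem union (hκ : ℵ₀ ≤ κ) {A B : Set X} (hA : IsKBorel κ A) (hB : IsKBorel κ B) :
    IsKBorel κ (A ∪ B) := by
  rw [Set.union_eq_iUnion]
  exact iUnion_of_countable hκ fun b => by cases b <;> assumption

theorem inter (hκ : ℵ₀ ≤ κ) {A B : Set X} (hA : IsKBorel κ A) (hB : IsKBorel κ B) :
    IsKBorel κ (A ∩ B) := by
  rw [← compl_compl (A ∩ B), Set.compl_inter]
  exact .compl _ (.union hκ (.compl _ hA) (.compl _ hB))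

theorem preimage {f : X → Y} (hf : IsKBorelMap κ f) {A : Set Y} (hA : IsKBorel κ A) :
    IsKBorel κ (f ⁻¹' A) := by
  induction hA with
  | of_isOpen U hU => exact hf U hU
  | compl A _ ih => exact .compl _ ih
  | iUnion o ho A _ ih => rw [Set.preimage_iUnion]; exact .iUnion o ho _ ih
  | iInter o ho A _ ih => rw [Set.preimage_iInter]; exact .iInter o ho _ ih

theorem setOf_exists {ι : Type*} (e : ι ↪ Below κ) {P : ι → X → Prop}
    (h : ∀ i, IsKBorel κ {x | P i x}) : IsKBorel κ {x | ∃ i, P i x} := by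
  rw [Set.ofPred_exists]
  exact iUnion_of_embedding e h

theorem setOf_forall {ι : Type*} (e : ι ↪ Below κ) {P : ι → X → Prop}
    (h : ∀ i, IsKBorel κ {x | P i x}) : IsKBorel κ {x | ∀ i, P i x} := by
  rw [Set.ofPred_forall]
  exact iInter_of_embedding e h

theorem setOf_and (hκ : ℵ₀ ≤ κ) {P Q : X → Prop} (hP : IsKBorel κ {x | P x})
    (hQ : IsKBorel κ {x | Q x}) : IsKBorel κ {x | P x ∧ Q x} :=
  hP.inter hκ hQ

theorem setOf_const_imp (p : Prop) {Q : X → Prop} (hQ : IsKBorel κ {x | Q x}) :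
    IsKBorel κ {x | p → Q x} := by
  by_cases h : p
  · simpa [h] using hQ
  · simpa [h] using univ

theorem setOf_const_and (p : Prop) {Q : X → Prop} (hQ : IsKBorel κ {x | Q x}) :
    IsKBorel κ {x | p ∧ Q x} := by
  by_cases h : p
  · simpa [h] using hQ
  · simpa [h] using empty

end IsKBorel

/-! ### Borel maps and reducibility -/

section Maps

variable {X : Type*} {Y : Type*} {Z : Type*} [TopologicalSpace X] [TopologicalSpace Y]
  [TopologicalSpace Z]

theorem IsKBorelMap.of_continuous {f : X → Y} (hf : Continuous f) : IsKBorelMap κ f :=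
  fun _ hU => .of_isOpen _ (hU.preimage hf)

theorem IsKBorelMap.comp {g : Y → Z} {f : X → Y} (hg : IsKBorelMap κ g) (hf : IsKBorelMap κ f) :
    IsKBorelMap κ (g ∘ f) :=
  fun U hU => (hg U hU).preimage hf

theorem BorelReducible.trans {E : X → X → Prop} {F : Y → Y → Prop} {G : Z → Z → Prop}
    (h₁ : BorelReducible κ E F) (h₂ : BorelReducible κ F G) : BorelReducible κ E G := by
  obtain ⟨f, hf, hEF⟩ := h₁
  obtain ⟨g, hg, hFG⟩ := h₂
  exact ⟨g ∘ f, hg.comp hf, fun x y => (hEF x y).trans (hFG _ _)⟩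

theorem BorelIsomorphic.borelReducible {E : X → X → Prop} {F : Y → Y → Prop}
    (h : BorelIsomorphic κ E F) : BorelReducible κ E F := by
  obtain ⟨φ, hφ, -, h⟩ := h
  exact ⟨φ, hφ, h⟩

theorem BorelIsomorphic.borelReducible_symm {E : X → X → Prop} {F : Y → Y → Prop}
    (h : BorelIsomorphic κ E F) : BorelReducible κ F E := by
  obtain ⟨φ, -, hφ, h⟩ := h
  exact ⟨φ.symm, hφ, fun x y => by simp [h]⟩

end Maps

/-! ### The topology of the generalized Cantor space -/

theorem isOpen_basicOpen (α : Below κ) (p : Cantor κ) : IsOpen (basicOpen κ α p) :=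
  .basic _ ⟨α, p, rfl⟩

theorem self_mem_basicOpen (α : Below κ) (p : Cantor κ) : p ∈ basicOpen κ α p := fun _ _ => rfl

theorem basicOpen_anti {α β : Below κ} (h : α ≤ β) (p : Cantor κ) :
    basicOpen κ β p ⊆ basicOpen κ α p := fun _ hη γ hγ => hη γ (hγ.trans_le h)

theorem basicOpen_eq_of_mem {α : Below κ} {p q : Cantor κ} (h : q ∈ basicOpen κ α p) :
    basicOpen κ α q = basicOpen κ α p := by
  ext η
  exact forall₂_congr fun β hβ => by rw [h β hβ]

theorem isOpen_iff_basicOpen (hr : κ.IsRegular) {U : Set (Cantor κ)} :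
    IsOpen U ↔ ∀ η ∈ U, ∃ α, basicOpen κ α η ⊆ U := by
  constructor
  · intro hU
    induction hU with
    | basic V hV =>
      obtain ⟨α, p, rfl⟩ := hV
      intro η hη
      exact ⟨α, (basicOpen_eq_of_mem hη).subset⟩
    | univ =>
      obtain ⟨a⟩ := nonempty_below hr
      exact fun η _ => ⟨a, Set.subset_univ _⟩
    | inter s t _ _ hs ht =>
      rintro η ⟨h₁, h₂⟩
      obtain ⟨α, hα⟩ := hs η h₁
      obtain ⟨β, hβ⟩ := ht η h₂
      exact ⟨max α β, Set.subset_inter ((basicOpen_anti (le_max_left _ _) η).trans hα)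
        ((basicOpen_anti (le_max_right _ _) η).trans hβ)⟩
    | sUnion S _ ih =>
      rintro η ⟨s, hs, hη⟩
      obtain ⟨α, hα⟩ := ih s hs η hη
      exact ⟨α, hα.trans (Set.subset_sUnion_of_mem hs)⟩
  · intro h
    have : U = ⋃ (η : U), basicOpen κ (h η.1 η.2).choose η.1 := by
      ext x
      simp only [Set.mem_iUnion]
      refine ⟨fun hx => ⟨⟨x, hx⟩, self_mem_basicOpen _ _⟩, ?_⟩
      rintro ⟨η, hη⟩
      exact (h η.1 η.2).choose_spec hη
    rw [this]
    exact isOpen_iUnion fun η => isOpen_basicOpen _ _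

theorem isOpen_coord (hr : κ.IsRegular) (β : Below κ) (b : Bool) :
    IsOpen {η : Cantor κ | η β = b} := by
  have := noMaxOrder_below hr
  obtain ⟨γ, hγ⟩ := exists_gt β
  refine (isOpen_iff_basicOpen hr).2 fun η hη => ⟨γ, fun ζ hζ => ?_⟩
  exact (hζ β hγ).trans hη

/-- A map into the generalized Cantor space is continuous if each of its coordinates depends on a
bounded part of the argument only. -/
theorem continuous_of_coord (hr : κ.IsRegular) {f : Cantor κ → Cantor κ}
    (h : ∀ β, ∃ δ, ∀ η ξ : Cantor κ, (∀ γ < δ, η γ = ξ γ) → f η β = f ξ β) : Continuous f := by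
  choose δ hδ using h
  refine continuous_generateFrom_iff.2 ?_
  rintro _ ⟨α, p, rfl⟩
  obtain ⟨ε, hε⟩ := exists_forall_Iio_lt hr α δ
  refine (isOpen_iff_basicOpen hr).2 fun η hη => ⟨ε, fun ζ hζ β hβ => ?_⟩
  rw [← hη β hβ]
  exact hδ β ζ η fun γ hγ => hζ γ (hγ.trans (hε β hβ))

/-! ### The Baire category theorem -/

/-- A set is comeager if it contains an intersection of `κ` many open dense sets. -/
def IsComeager (κ : Cardinal.{u}) (G : Set (Cantor κ)) : Prop :=
  ∃ V : Below κ → Set (Cantor κ), (∀ i, IsOpen (V i) ∧ Dense (V i)) ∧ (⋂ i, V i) ⊆ G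

theorem exists_mem_inter_basicOpen (hr : κ.IsRegular) {V : Set (Cantor κ)} (ho : IsOpen V)
    (hd : Dense V) (p : Cantor κ) (α β : Below κ) : ∃ q : Cantor κ, ∃ δ, β < δ ∧
      q ∈ basicOpen κ α p ∧ basicOpen κ δ q ⊆ V := by
  have := noMaxOrder_below hr
  obtain ⟨q, hq, hqV⟩ := hd.inter_open_nonempty _ (isOpen_basicOpen α p) ⟨p, self_mem_basicOpen α p⟩
  obtain ⟨δ, hδ⟩ := (isOpen_iff_basicOpen hr).1 ho q hqV
  obtain ⟨ε, hε⟩ := exists_gt (max β δ)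
  exact ⟨q, ε, (le_max_left _ _).trans_lt hε, hq,
    (basicOpen_anti ((le_max_right _ _).trans hε.le) q).trans hδ⟩

/-- The Baire category theorem for the generalized Cantor space. -/
theorem IsComeager.exists_mem (hr : κ.IsRegular) {G : Set (Cantor κ)} (hG : IsComeager κ G)
    (p : Cantor κ) (α : Below κ) : ∃ η ∈ G, η ∈ basicOpen κ α p := by
  classical
  have := noMaxOrder_below hr
  obtain ⟨V, hV, hVG⟩ := hG
  choose q δ hβδ hq hδ using fun i (r : Cantor κ) a b =>
    exists_mem_inter_basicOpen hr (hV i).1 (hV i).2 r a b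
  -- the gluing of a family of conditions given below `i`
  let glue : (i : Below κ) → ((j : Below κ) → j < i → Cantor κ × Below κ) → Cantor κ :=
    fun i F γ => if γ < α then p γ else
      if h : ∃ j, ∃ hj : j < i, γ < (F j hj).2 then
        (F (wellFounded_lt.min {j | ∃ hj : j < i, γ < (F j hj).2} h)
          (wellFounded_lt.min_mem {j | ∃ hj : j < i, γ < (F j hj).2} h).choose).1 γ
      else false
  have hbd : ∀ (i : Below κ) (F : (j : Below κ) → j < i → Cantor κ × Below κ),
      ∃ b, α ≤ b ∧ i ≤ b ∧ ∀ j (hj : j < i), (F j hj).2 ≤ b := by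
    intro i F
    obtain ⟨b, hb⟩ := exists_forall_Iio_lt hr i fun j => if hj : j < i then (F j hj).2 else i
    refine ⟨max (max α i) b, (le_max_left _ _).trans (le_max_left _ _),
      (le_max_right _ _).trans (le_max_left _ _), fun j hj => ?_⟩
    have := hb j hj
    rw [dif_pos hj] at this
    exact this.le.trans (le_max_right _ _)
  choose bd hbα hbi hbd using hbd
  -- Recursion of length `κ`: stage `i` keeps the gluing up to a bound above `α`, `i` and all
  -- earlier lengths, then enters `V i`. The gluing reads each coordinate off the first earlier
  -- condition that is long enough.
  let s : Below κ → Cantor κ × Below κ := wellFounded_lt.fix fun i F =>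
    (q i (glue i F) (bd i F) (bd i F), δ i (glue i F) (bd i F) (bd i F))
  let g : Below κ → Cantor κ := fun i => glue i fun j _ => s j
  let b : Below κ → Below κ := fun i => bd i fun j _ => s j
  have hs : ∀ i, s i = (q i (g i) (b i) (b i), δ i (g i) (b i) (b i)) := fun i =>
    wellFounded_lt.fix_eq _ i
  have hgt : ∀ i, i < (s i).2 := by
    intro i
    rw [hs i]
    exact (hbi i _).trans_lt (hβδ _ _ _ _)
  have hsg : ∀ i, ∀ γ < b i, (s i).1 γ = g i γ := by
    intro i γ hγ
    rw [hs i]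
    exact hq _ _ _ _ γ hγ
  have hp : ∀ i, ∀ γ < α, (s i).1 γ = p γ := by
    intro i γ hγ
    rw [hsg i γ (hγ.trans_le (hbα i _))]
    simp [g, glue, hγ]
  have hcoh : ∀ i, ∀ j < i, ∀ γ < (s j).2, (s i).1 γ = (s j).1 γ := by
    intro i
    induction i using WellFoundedLT.induction with
    | ind i ih =>
      intro j hj γ hγ
      by_cases hγα : γ < α
      · rw [hp i γ hγα, hp j γ hγα]
      rw [hsg i γ (hγ.trans_le (hbd i (fun j _ => s j) j hj))]
      have hne : ∃ k, ∃ _ : k < i, γ < (s k).2 := ⟨j, hj, hγ⟩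
      have hg : g i γ = (s (wellFounded_lt.min {k | ∃ _ : k < i, γ < (s k).2} hne)).1 γ := by
        simp only [g, glue, if_neg hγα]
        rw [dif_pos hne]
      rw [hg]
      set k := wellFounded_lt.min {k | ∃ _ : k < i, γ < (s k).2} hne with hk
      obtain ⟨-, hkγ⟩ : k ∈ {k | ∃ _ : k < i, γ < (s k).2} := wellFounded_lt.min_mem _ hne
      have hkj : k ≤ j := by
        refine not_lt.1 (wellFounded_lt.not_lt_min {k | ∃ _ : k < i, γ < (s k).2} (x := j) ?_)
        exact ⟨hj, hγ⟩
      rcases hkj.lt_or_eq with h | h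
      · exact (ih j hj k h γ hkγ).symm
      · rw [h]
  have hcoh' : ∀ i j, ∀ γ, γ < (s j).2 → γ < (s i).2 → (s i).1 γ = (s j).1 γ := by
    intro i j γ hj hi
    rcases lt_trichotomy i j with h | h | h
    · exact (hcoh j i h γ hi).symm
    · rw [h]
    · exact hcoh i j h γ hj
  -- The diagonal is the union of the conditions, since condition `γ` is longer than `γ`.
  refine ⟨fun γ => (s γ).1 γ, hVG (Set.mem_iInter.2 fun i => ?_), fun γ hγ => hp γ γ hγ⟩
  have : basicOpen κ (s i).2 (s i).1 ⊆ V i := by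
    rw [hs i]
    exact hδ _ _ _ _
  exact this fun γ hγ => hcoh' γ i γ hγ (hgt γ)

theorem IsComeager.iInter (hr : κ.IsRegular) {ι : Type*} (e : ι ↪ Below κ) {G : ι → Set (Cantor κ)}
    (hG : ∀ i, IsComeager κ (G i)) : IsComeager κ (⋂ i, G i) := by
  classical
  choose V hV hVG using hG
  obtain ⟨c⟩ := nonempty_prod_embedding hr
  let d : ι × Below κ ↪ Below κ := (e.prodMap (Function.Embedding.refl _)).trans c
  refine ⟨fun b => if h : ∃ x, d x = b then V h.choose.1 h.choose.2 else Set.univ, fun b => ?_, ?_⟩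
  · dsimp only
    split_ifs with h
    · exact hV _ _
    · exact ⟨isOpen_univ, dense_univ⟩
  · intro η hη
    refine Set.mem_iInter.2 fun i => hVG i (Set.mem_iInter.2 fun j => ?_)
    have h : ∃ x, d x = d (i, j) := ⟨_, rfl⟩
    have hη' := Set.mem_iInter.1 hη (d (i, j))
    rw [dif_pos h, d.injective h.choose_spec] at hη'
    exact hη'

theorem IsComeager.of_isOpen (hr : κ.IsRegular) {V : Set (Cantor κ)} (ho : IsOpen V)
    (hd : Dense V) : IsComeager κ V := by
  obtain ⟨a⟩ := nonempty_below hr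
  exact ⟨fun _ => V, fun _ => ⟨ho, hd⟩, fun η hη => Set.mem_iInter.1 hη a⟩

theorem IsComeager.mono {G H : Set (Cantor κ)} (hG : IsComeager κ G) (h : G ⊆ H) :
    IsComeager κ H := by
  obtain ⟨V, hV, hVG⟩ := hG
  exact ⟨V, hV, hVG.trans h⟩

theorem IsComeager.inter (hr : κ.IsRegular) {G H : Set (Cantor κ)} (hG : IsComeager κ G)
    (hH : IsComeager κ H) : IsComeager κ (G ∩ H) := by
  obtain ⟨e⟩ := IsKBorel.nonempty_embedding_of_countable hr.aleph0_le Bool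
  rw [Set.inter_eq_iInter]
  exact .iInter hr e fun b => by cases b <;> assumption

/-- `A` is relatively clopen in `G`. -/
def DecidedOn (κ : Cardinal.{u}) (G A : Set (Cantor κ)) : Prop :=
  ∀ η ∈ G, ∃ δ, ∀ ζ ∈ G, ζ ∈ basicOpen κ δ η → (ζ ∈ A ↔ η ∈ A)

theorem DecidedOn.mono {G H A : Set (Cantor κ)} (h : DecidedOn κ G A) (hH : H ⊆ G) :
    DecidedOn κ H A := by
  intro η hη
  obtain ⟨δ, hδ⟩ := h η (hH hη)
  exact ⟨δ, fun ζ hζ => hδ ζ (hH hζ)⟩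

theorem DecidedOn.compl {G A : Set (Cantor κ)} (h : DecidedOn κ G A) : DecidedOn κ G Aᶜ := by
  intro η hη
  obtain ⟨δ, hδ⟩ := h η hη
  exact ⟨δ, fun ζ hζ hζη => not_congr (hδ ζ hζ hζη)⟩

/-- The boundary of an open set is closed and nowhere dense; off it, membership is locally constant.
-/
theorem exists_decidedOn_of_isOpen (hr : κ.IsRegular) {U : Set (Cantor κ)} (hU : IsOpen U) :
    ∃ G, IsComeager κ G ∧ DecidedOn κ G U := by
  refine ⟨U ∪ (closure U)ᶜ, .of_isOpen hr (hU.union isClosed_closure.isOpen_compl) ?_, ?_⟩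
  · refine dense_iff_inter_open.2 fun W hW ⟨x, hx⟩ => ?_
    by_cases h : x ∈ closure U
    · obtain ⟨y, hyW, hyU⟩ := mem_closure_iff.1 h W hW hx
      exact ⟨y, hyW, Or.inl hyU⟩
    · exact ⟨x, hx, Or.inr h⟩
  · rintro η (hη | hη)
    · obtain ⟨δ, hδ⟩ := (isOpen_iff_basicOpen hr).1 hU η hη
      exact ⟨δ, fun ζ _ hζ => iff_of_true (hδ hζ) hη⟩
    · obtain ⟨δ, hδ⟩ := (isOpen_iff_basicOpen hr).1 isClosed_closure.isOpen_compl η hη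
      exact ⟨δ, fun ζ _ hζ => iff_of_false (fun h => hδ hζ (subset_closure h))
        fun h => hη (subset_closure h)⟩

/-- On the intersection of the given comeager sets the union is relatively open, so there it is the
trace of an open set, to which the open case applies. -/
theorem exists_decidedOn_iUnion (hr : κ.IsRegular) {ι : Type*} (e : ι ↪ Below κ)
    {A : ι → Set (Cantor κ)} (h : ∀ i, ∃ G, IsComeager κ G ∧ DecidedOn κ G (A i)) :
    ∃ G, IsComeager κ G ∧ DecidedOn κ G (⋃ i, A i) := by
  choose G hG hGA using h
  let H := ⋂ i, G i
  have hH : IsComeager κ H := .iInter hr e hG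
  let W : Set (Cantor κ) := {η | ∃ δ, ∀ ζ ∈ H, ζ ∈ basicOpen κ δ η → ζ ∈ ⋃ i, A i}
  have hW : IsOpen W := by
    refine (isOpen_iff_basicOpen hr).2 ?_
    rintro η ⟨δ, hδ⟩
    refine ⟨δ, fun ξ hξ => ⟨δ, fun ζ hζ hζξ => hδ ζ hζ ?_⟩⟩
    rwa [← basicOpen_eq_of_mem hξ]
  obtain ⟨K, hK, hKW⟩ := exists_decidedOn_of_isOpen hr hW
  refine ⟨H ∩ K, hH.inter hr hK, ?_⟩
  have hWA : ∀ η ∈ H, η ∈ W ↔ η ∈ ⋃ i, A i := by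
    intro η hη
    refine ⟨fun ⟨δ, hδ⟩ => hδ η hη (self_mem_basicOpen _ _), fun h => ?_⟩
    obtain ⟨i, hi⟩ := Set.mem_iUnion.1 h
    obtain ⟨δ, hδ⟩ := hGA i η (Set.mem_iInter.1 hη i)
    exact ⟨δ, fun ζ hζ hζη => Set.mem_iUnion.2 ⟨i, (hδ ζ (Set.mem_iInter.1 hζ i) hζη).2 hi⟩⟩
  rintro η ⟨hηH, hηK⟩
  obtain ⟨δ, hδ⟩ := hKW η hηK
  refine ⟨δ, fun ζ hζ hζη => ?_⟩
  rw [← hWA ζ hζ.1, ← hWA η hηH]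
  exact hδ ζ hζ.2 hζη

/-- Every Borel set is relatively clopen in a comeager set. -/
theorem IsKBorel.exists_decidedOn (hr : κ.IsRegular) {A : Set (Cantor κ)} (hA : IsKBorel κ A) :
    ∃ G, IsComeager κ G ∧ DecidedOn κ G A := by
  have emb : ∀ o : Ordinal.{u}, o ≤ κ.ord → Set.Iio o ↪ Below κ := fun o ho =>
    ⟨fun x => ⟨x.1, lt_of_lt_of_le (Set.mem_Iio.1 x.2) ho⟩, fun x y h => Subtype.ext (Subtype.mk.inj h)⟩
  induction hA with
  | of_isOpen U hU => exact exists_decidedOn_of_isOpen hr hU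
  | compl A _ ih =>
    obtain ⟨G, hG, h⟩ := ih
    exact ⟨G, hG, h.compl⟩
  | iUnion o ho A _ ih => exact exists_decidedOn_iUnion hr (emb o ho) ih
  | iInter o ho A _ ih =>
    obtain ⟨G, hG, h⟩ := exists_decidedOn_iUnion hr (emb o ho) (A := fun i => (A i)ᶜ) fun i => by
      obtain ⟨G, hG, h⟩ := ih i
      exact ⟨G, hG, h.compl⟩
    refine ⟨G, hG, ?_⟩
    rw [← compl_compl (⋂ i, A i), Set.compl_iInter]
    exact h.compl

theorem symmDiffFun_symmDiffFun (c η : Cantor κ) : symmDiffFun κ (symmDiffFun κ η c) c = η := by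
  funext γ
  simp [symmDiffFun]

theorem IsComeager.preimage_symmDiffFun (hr : κ.IsRegular) {G : Set (Cantor κ)}
    (hG : IsComeager κ G) (c : Cantor κ) : IsComeager κ ((fun η => symmDiffFun κ η c) ⁻¹' G) := by
  have := noMaxOrder_below hr
  have hc : Continuous fun η => symmDiffFun κ η c := by
    refine continuous_of_coord hr fun β => ?_
    obtain ⟨δ, hδ⟩ := exists_gt β
    exact ⟨δ, fun η ξ h => by simp [symmDiffFun, h β hδ]⟩
  have hh : Function.Involutive fun η => symmDiffFun κ η c := symmDiffFun_symmDiffFun c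
  let φ : Cantor κ ≃ₜ Cantor κ := ⟨hh.toPerm, hc, hc⟩
  obtain ⟨V, hV, hVG⟩ := hG
  refine ⟨fun i => φ ⁻¹' V i, fun i => ⟨(hV i).1.preimage hc, (hV i).2.preimage φ.isOpenMap⟩, ?_⟩
  rw [← Set.preimage_iInter]
  exact Set.preimage_mono hVG

/-- In a comeager set one finds pairs extending given bounded parts whose symmetric difference is
constant from there on. -/
theorem IsComeager.exists_pair (hr : κ.IsRegular) {G : Set (Cantor κ)} (hG : IsComeager κ G)
    (η ξ : Cantor κ) (δ : Below κ) (b : Bool) :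
    ∃ η' ∈ G, ∃ ξ' ∈ G, η' ∈ basicOpen κ δ η ∧ ξ' ∈ basicOpen κ δ ξ ∧
      ∀ γ, δ ≤ γ → symmDiffFun κ η' ξ' γ = b := by
  classical
  -- Translation by `c` preserves comeagerness, so some `ζ` extending `η` below `δ` has both `ζ` and
  -- `ζ + c` in `G`; below `δ`, adding `c` turns `η` into `ξ`.
  let c : Cantor κ := fun γ => if γ < δ then xor (η γ) (ξ γ) else b
  obtain ⟨ζ, ⟨h₁, h₂⟩, hζ⟩ := (hG.inter hr (hG.preimage_symmDiffFun hr c)).exists_mem hr η δ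
  refine ⟨ζ, h₁, _, h₂, hζ, fun γ hγ => ?_, fun γ hγ => ?_⟩
  · simp [symmDiffFun, c, hγ, hζ γ hγ]
  · simp [symmDiffFun, c, hγ.not_gt]

/-! ### The relations `E_S` -/

theorem symmDiffFun_comm (η ξ : Cantor κ) : symmDiffFun κ η ξ = symmDiffFun κ ξ η :=
  funext fun _ => Bool.xor_comm _ _

theorem symmDiffFun_eq_false {η ξ : Cantor κ} {γ : Below κ} :
    symmDiffFun κ η ξ γ = false ↔ η γ = ξ γ := by
  simp [symmDiffFun]

/-- The symmetric difference of `η` and `ξ` is constant on a final segment of the ordinals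
below `s`. -/
def EventuallyConstBelow (s : Below κ) (η ξ : Cantor κ) : Prop :=
  ∃ β < s, ∃ b : Bool, ∀ γ ∈ Set.Ioo β s, symmDiffFun κ η ξ γ = b

theorem exists_lt_of_mem_cofOmega {s : Below κ} (hs : s ∈ cofOmega κ) : ∃ β, β < s := by
  obtain ⟨a, ha, -⟩ := exists_seq_of_mem_cofOmega hs
  exact ⟨a 0, ha 0⟩

theorem EventuallyConstBelow.of_eqOn {s : Below κ} (hs : s ∈ cofOmega κ) {η ξ : Cantor κ}
    (h : ∀ γ < s, η γ = ξ γ) : EventuallyConstBelow s η ξ := by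
  obtain ⟨β, hβ⟩ := exists_lt_of_mem_cofOmega hs
  exact ⟨β, hβ, false, fun γ hγ => symmDiffFun_eq_false.2 (h γ hγ.2)⟩

theorem EventuallyConstBelow.symm {s : Below κ} {η ξ : Cantor κ}
    (h : EventuallyConstBelow s η ξ) : EventuallyConstBelow s ξ η := by
  rwa [EventuallyConstBelow, symmDiffFun_comm]

theorem EventuallyConstBelow.trans {s : Below κ} {η ξ ζ : Cantor κ}
    (h : EventuallyConstBelow s η ξ) (h' : EventuallyConstBelow s ξ ζ) :
    EventuallyConstBelow s η ζ := by
  obtain ⟨β, hβ, b, hb⟩ := h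
  obtain ⟨β', hβ', b', hb'⟩ := h'
  refine ⟨max β β', max_lt hβ hβ', xor b b', fun γ hγ => ?_⟩
  rw [← hb γ ⟨(le_max_left _ _).trans_lt hγ.1, hγ.2⟩,
    ← hb' γ ⟨(le_max_right _ _).trans_lt hγ.1, hγ.2⟩]
  simp only [symmDiffFun]
  cases η γ <;> cases ξ γ <;> cases ζ γ <;> rfl

theorem EventuallyConstBelow.congr {s : Below κ} {η ξ η' ξ' : Cantor κ}
    (h : EventuallyConstBelow s η ξ) (hη : ∀ γ < s, η' γ = η γ) (hξ : ∀ γ < s, ξ' γ = ξ γ) :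
    EventuallyConstBelow s η' ξ' := by
  obtain ⟨β, hβ, b, hb⟩ := h
  refine ⟨β, hβ, b, fun γ hγ => ?_⟩
  rw [← hb γ hγ]
  simp [symmDiffFun, hη γ hγ.2, hξ γ hγ.2]

theorem eStar_iff {S : Set (Below κ)} {η ξ : Cantor κ} :
    EStar κ S η ξ ↔ ∀ s ∈ S, EventuallyConstBelow s η ξ := Iff.rfl

theorem e0_iff {η ξ : Cantor κ} : E0 κ η ξ ↔ ∃ β : Below κ, ∀ γ, β ≤ γ → η γ = ξ γ := by
  refine exists_congr fun β => forall_congr' fun γ => ?_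
  rw [← not_lt, not_imp_comm]

/-- Constant differences add modulo 2. The cofinality assumption matters only for reflexivity, where
it excludes `0` from `S`. -/
theorem equivalence_ES (hr : κ.IsRegular) {S : Set (Below κ)} (hS : S ⊆ cofOmega κ) :
    Equivalence (ES κ S) := by
  refine ⟨fun η => ⟨eStar_iff.2 fun s hs => .of_eqOn (hS hs) fun _ _ => rfl, ?_⟩, ?_, ?_⟩
  · obtain ⟨a⟩ := nonempty_below hr
    exact e0_iff.2 ⟨a, fun _ _ => rfl⟩
  · rintro η ξ ⟨h, h'⟩
    obtain ⟨β, hβ⟩ := e0_iff.1 h'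
    exact ⟨fun s hs => EventuallyConstBelow.symm (h s hs), e0_iff.2 ⟨β, fun γ hγ => (hβ γ hγ).symm⟩⟩
  · rintro η ξ ζ ⟨h₁, h₁'⟩ ⟨h₂, h₂'⟩
    obtain ⟨β, hβ⟩ := e0_iff.1 h₁'
    obtain ⟨β', hβ'⟩ := e0_iff.1 h₂'
    exact ⟨fun s hs => EventuallyConstBelow.trans (h₁ s hs) (h₂ s hs),
      e0_iff.2 ⟨max β β', fun γ hγ => (hβ γ ((le_max_left _ _).trans hγ)).trans
        (hβ' γ ((le_max_right _ _).trans hγ))⟩⟩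

theorem eS_empty_iff {η ξ : Cantor κ} : ES κ ∅ η ξ ↔ E0 κ η ξ :=
  ⟨fun h => h.2, fun h => ⟨fun _ hs => hs.elim, h⟩⟩

/-! ### Disjoint unions -/

theorem equivalence_directSum {m : Ordinal.{u}} {E : Ordinal.{u} → Cantor κ → Cantor κ → Prop}
    (hE : ∀ k < m, Equivalence (E k)) : Equivalence (directSum κ m E) := by
  refine ⟨fun x => ⟨rfl, (hE x.1 x.1.2).refl _⟩, ?_, ?_⟩
  · rintro ⟨k, η⟩ ⟨l, ξ⟩ ⟨h, h'⟩
    obtain rfl : k = l := h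
    exact ⟨rfl, (hE k k.2).symm h'⟩
  · rintro ⟨k, η⟩ ⟨l, ξ⟩ ⟨n, ζ⟩ ⟨h₁, h₁'⟩ ⟨h₂, h₂'⟩
    obtain rfl : k = l := h₁
    obtain rfl : k = n := h₂
    exact ⟨rfl, (hE k k.2).trans h₁' h₂'⟩

theorem isOpen_sigma_fst {m : Ordinal.{u}} (k : Set.Iio m) :
    IsOpen {s : Σ _ : Set.Iio m, Cantor κ | s.1 = k} :=
  isOpen_sigma_iff.2 fun j => isOpen_const (p := j = k)

theorem isOpen_sigma_coord (hr : κ.IsRegular) {m : Ordinal.{u}} (γ : Below κ) (b : Bool) :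
    IsOpen {s : Σ _ : Set.Iio m, Cantor κ | s.2 γ = b} :=
  isOpen_sigma_iff.2 fun _ => isOpen_coord hr γ b

/-- The relation is defined from conditions on single coordinates by quantifiers over sets of size
at most `κ`. The map `φ` allows for the pullback to `2^κ`. -/
theorem isKBorel_directSum (hr : κ.IsRegular) {X : Type*} [TopologicalSpace X] {m : Ordinal.{u}}
    (e : Set.Iio m ↪ Below κ) (S : Ordinal.{u} → Set (Below κ))
    {φ : X → Σ _ : Set.Iio m, Cantor κ} (hφ : IsKBorelMap κ φ) :
    IsKBorel κ {p : X × X | directSum κ m (fun k => ES κ (S k)) (φ p.1) (φ p.2)} := by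
  have hκ := hr.aleph0_le
  obtain ⟨b2⟩ := IsKBorel.nonempty_embedding_of_countable hκ Bool
  have h₁ : IsKBorelMap κ fun p : X × X => φ p.1 :=
    IsKBorelMap.comp hφ (.of_continuous continuous_fst)
  have h₂ : IsKBorelMap κ fun p : X × X => φ p.2 :=
    IsKBorelMap.comp hφ (.of_continuous continuous_snd)
  have hsd : ∀ γ b, IsKBorel κ {p : X × X | symmDiffFun κ (φ p.1).2 (φ p.2).2 γ = b} := by
    intro γ b
    have : {p : X × X | symmDiffFun κ (φ p.1).2 (φ p.2).2 γ = b} =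
        {p : X × X | ∃ c, (φ p.1).2 γ = c ∧ (φ p.2).2 γ = xor c b} := by
      ext p
      simp only [symmDiffFun, Set.mem_ofPred_eq, exists_eq_left']
      cases (φ p.1).2 γ <;> cases (φ p.2).2 γ <;> cases b <;> simp
    rw [this]
    exact .setOf_exists b2 fun c => .setOf_and hκ (h₁ _ (isOpen_sigma_coord hr γ c))
      (h₂ _ (isOpen_sigma_coord hr γ _))
  have : {p : X × X | directSum κ m (fun k => ES κ (S k)) (φ p.1) (φ p.2)} =
      {p : X × X | ∃ k : Set.Iio m, ((φ p.1).1 = k ∧ (φ p.2).1 = k) ∧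
        (∀ s, s ∈ S k → ∃ β, β < s ∧ ∃ b, ∀ γ, γ ∈ Set.Ioo β s →
          symmDiffFun κ (φ p.1).2 (φ p.2).2 γ = b) ∧
        ∃ β, ∀ γ, β ≤ γ → symmDiffFun κ (φ p.1).2 (φ p.2).2 γ = false} := by
    ext p
    simp only [Set.mem_ofPred_eq, directSum, ES, e0_iff, EStar, symmDiffFun_eq_false]
    constructor
    · rintro ⟨h, h'⟩
      exact ⟨_, ⟨rfl, h.symm⟩, h'⟩
    · rintro ⟨k, ⟨rfl, h⟩, h'⟩
      exact ⟨h.symm, h'⟩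
  rw [this]
  refine .setOf_exists e fun k => .setOf_and hκ
    (.setOf_and hκ (h₁ _ (isOpen_sigma_fst k)) (h₂ _ (isOpen_sigma_fst k))) (.setOf_and hκ ?_ ?_)
  · exact .setOf_forall (.refl _) fun s => .setOf_const_imp _ <| .setOf_exists (.refl _) fun β =>
      .setOf_const_and _ <| .setOf_exists b2 fun b => .setOf_forall (.refl _) fun γ =>
      .setOf_const_imp _ (hsd γ b)
  · exact .setOf_exists (.refl _) fun β => .setOf_forall (.refl _) fun γ =>
      .setOf_const_imp _ (hsd γ false)

/-! ### Reductions to `E₀` -/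

theorem nonempty_cantor_Iic_embedding (hr : κ.IsRegular) (hpow : κ ^< κ = κ) (α : Below κ) :
    Nonempty ((Set.Iic α → Bool) ↪ Below κ) := by
  obtain ⟨c, hc, hcκ⟩ := Cardinal.lt_lift_iff.1 (mk_Iic_below hr α)
  rw [← Cardinal.le_def, mk_below]
  simp only [Cardinal.mk_pi, Cardinal.mk_bool, Cardinal.prod_const, ← hcκ]
  have h2 : (2 : Cardinal.{u}) ≤ κ := (Cardinal.ofNat_lt_aleph0 (n := 2)).le.trans hr.aleph0_le
  have : (2 : Cardinal.{u}) ^ c ≤ κ :=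
    (Cardinal.power_le_power_right h2).trans ((Cardinal.le_powerlt κ hc).trans hpow.le)
  simpa using Cardinal.lift_le.{u + 1}.2 this

open Classical in
/-- The graph of a function `κ → κ`, as an element of the generalized Cantor space. -/
noncomputable def graph (e : Below κ × Below κ ↪ Below κ) (c : Below κ → Below κ) : Cantor κ :=
  fun β => decide (∃ α, β = e (α, c α))

theorem graph_apply {e : Below κ × Below κ ↪ Below κ} {c : Below κ → Below κ} {α y : Below κ} :
    graph e c (e (α, y)) = true ↔ c α = y := by
  simp only [graph, decide_eq_true_eq, e.injective.eq_iff, Prod.mk.injEq]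
  constructor
  · rintro ⟨_, rfl, rfl⟩
    rfl
  · rintro rfl
    exact ⟨α, rfl, rfl⟩

/-- By regularity, graphs differ on a bounded set of codes exactly when the functions differ at a
bounded set of arguments. So equality modulo bounded sets on `κ^κ` sits inside `E₀`. -/
theorem e0_graph_iff (hr : κ.IsRegular) (e : Below κ × Below κ ↪ Below κ)
    (c d : Below κ → Below κ) :
    E0 κ (graph e c) (graph e d) ↔ ∃ B, ∀ α, B ≤ α → c α = d α := by
  constructor
  · rintro ⟨B, hB⟩
    -- If `c α ≠ d α`, the graphs differ at `e (α, c α)`, which is therefore below `B`.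
    have hD : #{α | c α ≠ d α} ≤ #(Set.Iio B) := by
      refine Cardinal.mk_le_of_injective (f := fun α => ⟨e (α.1, c α.1), hB _ ?_⟩) ?_
      · intro h
        rw [graph_apply.2 rfl] at h
        exact α.2 (graph_apply.1 h.symm).symm
      · intro α α' h
        have := e.injective (Subtype.mk.inj h)
        exact Subtype.ext (Prod.mk.inj this).1
    obtain ⟨B', hB'⟩ := exists_forall_lt_of_mk_lt hr _ (hD.trans_lt (mk_Iio_below B))
    exact ⟨B', fun α hα => by_contra fun h => (hB' α h).not_ge hα⟩
  · rintro ⟨B, hB⟩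
    obtain ⟨b₁, h₁⟩ := exists_forall_Iio_lt hr B fun α => e (α, c α)
    obtain ⟨b₂, h₂⟩ := exists_forall_Iio_lt hr B fun α => e (α, d α)
    refine e0_iff.2 ⟨max b₁ b₂, fun β hβ => ?_⟩
    rw [Bool.eq_iff_iff]
    simp only [graph, decide_eq_true_eq]
    refine exists_congr fun α => ?_
    by_cases hα : B ≤ α
    · rw [hB α hα]
    · have := h₁ α (not_le.1 hα)
      have := h₂ α (not_le.1 hα)
      have := (le_max_left b₁ b₂).trans hβ
      have := (le_max_right b₁ b₂).trans hβ
      refine iff_of_false ?_ ?_ <;> rintro rfl <;> order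

/-- Codes for the equivalence classes of the restrictions of the elements of a disjoint union. -/
theorem exists_code (hr : κ.IsRegular) (hpow : κ ^< κ = κ) {m : Ordinal.{u}}
    (e : Set.Iio m ↪ Below κ) {S : Ordinal.{u} → Set (Below κ)}
    (hS : ∀ k < m, S k ⊆ cofOmega κ) :
    ∃ c : (Σ _ : Set.Iio m, Cantor κ) → Below κ → Below κ, ∀ x y α, c x α = c y α ↔
      x.1 = y.1 ∧ x.2 α = y.2 α ∧ ∀ s ∈ S x.1, s ≤ α → EventuallyConstBelow s x.2 y.2 := by
  obtain ⟨p⟩ := nonempty_prod_embedding hr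
  let r : Below κ → Setoid (Σ _ : Set.Iio m, Cantor κ) := fun α =>
    { r := fun x y => x.1 = y.1 ∧ x.2 α = y.2 α ∧
        ∀ s ∈ S x.1, s ≤ α → EventuallyConstBelow s x.2 y.2
      iseqv := by
        refine ⟨fun x => ⟨rfl, rfl, fun s hs _ => .of_eqOn (hS _ x.1.2 hs) fun _ _ => rfl⟩, ?_, ?_⟩
        · rintro x y ⟨h₁, h₂, h₃⟩
          exact ⟨h₁.symm, h₂.symm, fun s hs hα => (h₃ s (h₁ ▸ hs) hα).symm⟩
        · rintro x y z ⟨h₁, h₂, h₃⟩ ⟨k₁, k₂, k₃⟩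
          exact ⟨h₁.trans k₁, h₂.trans k₂,
            fun s hs hα => (h₃ s hs hα).trans (k₃ s (h₁ ▸ hs) hα)⟩ }
  -- The class of `x` is determined by its copy and its restriction to `[0, α]`, so there are at
  -- most `κ` classes.
  have hq : ∀ α, ∃ d : Quotient (r α) → Below κ, Function.Injective d := by
    intro α
    obtain ⟨t⟩ := nonempty_cantor_Iic_embedding hr hpow α
    refine ⟨fun q => p (e q.out.1, t fun γ => q.out.2 γ.1), fun q q' h => ?_⟩
    obtain ⟨h₁, h₂⟩ := Prod.mk.inj (p.injective h)
    have h₃ : ∀ γ ≤ α, q.out.2 γ = q'.out.2 γ := fun γ hγ => congrFun (t.injective h₂) ⟨γ, hγ⟩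
    rw [← q.out_eq, ← q'.out_eq]
    exact Quotient.sound ⟨e.injective h₁, h₃ α le_rfl, fun s hs hα =>
      .of_eqOn (hS _ q.out.1.2 hs) fun γ hγ => h₃ γ (hγ.le.trans hα)⟩
  choose d hd using hq
  refine ⟨fun x α => d α (Quotient.mk (r α) x), fun x y α => ?_⟩
  rw [(hd α).eq_iff, Quotient.eq]
  rfl

theorem borelReducible_directSum_E0 (hr : κ.IsRegular) (hpow : κ ^< κ = κ) {m : Ordinal.{u}}
    (e : Set.Iio m ↪ Below κ) {S : Ordinal.{u} → Set (Below κ)}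
    (hS : ∀ k < m, S k ⊆ cofOmega κ) :
    BorelReducible κ (directSum κ m fun k => ES κ (S k)) (E0 κ) := by
  have := noMaxOrder_below hr
  obtain ⟨p⟩ := nonempty_prod_embedding hr
  obtain ⟨c, hc⟩ := exists_code hr hpow e hS
  refine ⟨fun x => graph p (c x), .of_continuous (continuous_sigma fun k => ?_), fun x y => ?_⟩
  · refine continuous_of_coord hr fun β => ?_
    by_cases h : ∃ α y, β = p (α, y)
    · obtain ⟨α, y, rfl⟩ := h
      obtain ⟨δ, hδ⟩ := exists_gt α
      refine ⟨δ, fun η ξ hηξ => ?_⟩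
      have : c ⟨k, η⟩ α = c ⟨k, ξ⟩ α := (hc _ _ _).2 ⟨rfl, hηξ α hδ, fun s hs hα =>
        .of_eqOn (hS _ k.2 hs) fun γ hγ => hηξ γ (hγ.trans_le (hα.trans hδ.le))⟩
      rw [Bool.eq_iff_iff, graph_apply, graph_apply, this]
    · refine ⟨β, fun η ξ _ => ?_⟩
      have : ∀ d, graph p d β = false := by
        intro d
        simp only [graph, decide_eq_false_iff_not]
        rintro ⟨α, h'⟩
        exact h ⟨_, _, h'⟩
      rw [this, this]
  · rw [e0_graph_iff hr]
    simp only [hc, directSum, ES, e0_iff]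
    constructor
    · rintro ⟨h, h', B, hB⟩
      exact ⟨B, fun α hα => ⟨h, hB α hα, fun s hs _ => h' s hs⟩⟩
    · rintro ⟨B, hB⟩
      -- The condition at `s`, even for `s` below `B`, is read off the code at `max B s`.
      exact ⟨(hB B le_rfl).1, fun s hs => (hB (max B s) (le_max_left _ _)).2.2 s hs (le_max_right _ _),
        B, fun α hα => (hB α hα).2.1⟩

/-! ### Borel isomorphisms -/

/-- The `σ`-algebra of the Borel sets of the generalized theory. -/
abbrev kBorel (hκ : ℵ₀ ≤ κ) (X : Type*) [TopologicalSpace X] : MeasurableSpace X where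
  MeasurableSet' := IsKBorel κ
  measurableSet_empty := .empty
  measurableSet_compl := .compl
  measurableSet_iUnion _ := .iUnion_of_countable hκ

theorem IsKBorelMap.measurable (hκ : ℵ₀ ≤ κ) {X Y : Type*} [TopologicalSpace X]
    [TopologicalSpace Y] {f : X → Y} (hf : IsKBorelMap κ f) :
    @Measurable _ _ (kBorel hκ X) (kBorel hκ Y) f :=
  fun _ hA => IsKBorel.preimage hf hA

/-- Schröder–Bernstein for Borel embeddings; its proof uses only countable Boolean operations, so
the `σ`-algebra `kBorel` suffices. -/
theorem exists_borel_equiv_sigma (hr : κ.IsRegular) {m : Ordinal.{u}} (hm : 0 < m)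
    (e : Set.Iio m ↪ Below κ) :
    ∃ φ : Cantor κ ≃ Σ _ : Set.Iio m, Cantor κ, IsKBorelMap κ φ ∧ IsKBorelMap κ φ.symm := by
  classical
  have := noMaxOrder_below hr
  have hκ := hr.aleph0_le
  obtain ⟨c⟩ := nonempty_prod_bool_embedding hr
  obtain ⟨h⟩ : Nonempty (Below κ × Bool ≃ Below κ) :=
    Function.Embedding.antisymm c ⟨fun γ => (γ, true), fun _ _ h => (Prod.mk.inj h).1⟩
  let j₀ : Set.Iio m := ⟨0, hm⟩
  let _ : MeasurableSpace (Cantor κ) := kBorel hκ _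
  let _ : MeasurableSpace (Σ _ : Set.Iio m, Cantor κ) := kBorel hκ _
  have hmk : ∀ j : Set.Iio m, Continuous fun η : Cantor κ =>
      (⟨j, η⟩ : Σ _ : Set.Iio m, Cantor κ) := fun j =>
    continuous_sigmaMk (σ := fun _ : Set.Iio m => Cantor κ) (i := j)
  let f : Cantor κ → Σ _ : Set.Iio m, Cantor κ := fun η => ⟨j₀, η⟩
  let f' : (Σ _ : Set.Iio m, Cantor κ) → Cantor κ := fun x => x.2
  have hf : MeasurableEmbedding f := by
    refine MeasurableEmbedding.of_measurable_inverse (g := f')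
      (IsKBorelMap.measurable hκ (.of_continuous (hmk j₀))) ?_
      (IsKBorelMap.measurable hκ (.of_continuous (continuous_sigma fun _ => continuous_id)))
      fun _ => rfl
    exact .of_isOpen _ isOpen_range_sigmaMk
  -- Half of the coordinates carry the point, the other half the indicator of the code of its copy.
  let g : (Σ _ : Set.Iio m, Cantor κ) → Cantor κ := fun x β =>
    if (h.symm β).2 then x.2 (h.symm β).1 else decide ((h.symm β).1 = e x.1)
  let P : Set.Iio m → Cantor κ → Prop := fun j ζ => ∀ γ, ζ (h (γ, false)) = decide (γ = e j)
  let q : Cantor κ → Cantor κ := fun ζ γ => ζ (h (γ, true))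
  -- The copy `j₀` is an arbitrary default off the range of `g`.
  let g' : Cantor κ → Σ _ : Set.Iio m, Cantor κ := fun ζ =>
    if hj : ∃ j, P j ζ then ⟨hj.choose, q ζ⟩ else ⟨j₀, q ζ⟩
  have hP : ∀ {j j' ζ}, P j ζ → P j' ζ → j = j' := by
    intro j j' ζ h₁ h₂
    have := (h₁ (e j)).symm.trans (h₂ (e j))
    simpa using this
  have hPg : ∀ x, P x.1 (g x) := by
    intro x γ
    simp [g]
  have hqg : ∀ x, q (g x) = x.2 := by
    intro x
    funext γ
    simp [g, q]
  have hg'pos : ∀ j ζ, P j ζ → g' ζ = ⟨j, q ζ⟩ := by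
    intro j ζ hj
    have hj' : ∃ k, P k ζ := ⟨j, hj⟩
    simp only [g', dif_pos hj']
    rw [hP hj'.choose_spec hj]
  have hg'neg : ∀ ζ, (¬ ∃ j, P j ζ) → g' ζ = ⟨j₀, q ζ⟩ := fun ζ hj => dif_neg hj
  have hg'g : Function.LeftInverse g' g := by
    intro x
    rw [hg'pos x.1 _ (hPg x), hqg]
  have hPB : ∀ j, IsKBorel κ {ζ | P j ζ} := fun j =>
    .setOf_forall (.refl _) fun γ => .of_isOpen _ (isOpen_coord hr _ _)
  have hq : Continuous q := by
    refine continuous_of_coord hr fun β => ?_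
    obtain ⟨δ, hδ⟩ := exists_gt (h (β, true))
    exact ⟨δ, fun η ξ hηξ => hηξ _ hδ⟩
  have hgc : Continuous g := by
    refine continuous_sigma fun j => continuous_of_coord hr fun β => ?_
    obtain ⟨δ, hδ⟩ := exists_gt (h.symm β).1
    refine ⟨δ, fun η ξ hηξ => ?_⟩
    simp [g, hηξ _ hδ]
  have hg'm : IsKBorelMap κ g' := by
    intro U hU
    have hopen : ∀ j : Set.Iio m, IsKBorel κ {ζ | (⟨j, q ζ⟩ : Σ _ : Set.Iio m, Cantor κ) ∈ U} :=
      fun j => .of_isOpen _ (hU.preimage ((hmk j).comp hq))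
    have : g' ⁻¹' U = {ζ | ∃ j, P j ζ ∧ (⟨j, q ζ⟩ : Σ _ : Set.Iio m, Cantor κ) ∈ U} ∪
        ({ζ | ∃ j, P j ζ}ᶜ ∩ {ζ | (⟨j₀, q ζ⟩ : Σ _ : Set.Iio m, Cantor κ) ∈ U}) := by
      ext ζ
      rw [Set.mem_preimage]
      constructor
      · intro hU
        by_cases hj : ∃ j, P j ζ
        · obtain ⟨j, hj⟩ := hj
          rw [hg'pos j ζ hj] at hU
          exact Or.inl ⟨j, hj, hU⟩
        · rw [hg'neg ζ hj] at hU
          exact Or.inr ⟨hj, hU⟩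
      · rintro (⟨j, hj, hU⟩ | ⟨hj, hU⟩)
        · rwa [hg'pos j ζ hj]
        · rwa [hg'neg ζ hj]
    rw [this]
    exact .union hκ (.setOf_exists e fun j => .setOf_and hκ (hPB j) (hopen j))
      (.inter hκ (.compl _ (.setOf_exists e hPB)) (hopen j₀))
  have hg : MeasurableEmbedding g := by
    refine MeasurableEmbedding.of_measurable_inverse (g := g')
      (IsKBorelMap.measurable hκ (.of_continuous hgc)) ?_ (hg'm.measurable hκ) hg'g
    have : Set.range g = {ζ | ∃ j, P j ζ} := by
      ext ζ
      constructor
      · rintro ⟨x, rfl⟩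
        exact ⟨x.1, hPg x⟩
      · rintro ⟨j, hj⟩
        refine ⟨⟨j, q ζ⟩, funext fun β => ?_⟩
        obtain ⟨⟨γ, b⟩, rfl⟩ := h.surjective β
        cases b
        · simp [g, hj γ]
        · simp [g, q]
    rw [this]
    exact IsKBorel.setOf_exists e hPB
  let φ := MeasurableEmbedding.schroederBernstein hf hg
  exact ⟨φ.toEquiv, fun U hU => φ.measurable (.of_isOpen U hU),
    fun U hU => φ.symm.measurable (.of_isOpen U hU)⟩

/-! ### Non-reducibility -/

/-- Ordinals closed under a function on finite sequences of ordinals form a club. -/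
theorem exists_isClub_closed_list (hκ : ℵ₀ < κ) (hr : κ.IsRegular)
    (F : List (Below κ) → Below κ) :
    ∃ C, IsClub C ∧ ∀ α ∈ C, (∃ β, β < α) → ∀ l : List (Below κ), (∀ x ∈ l, x < α) → F l < α := by
  -- Uncountability of `κ` enters here: there are fewer than `κ` finite sequences from `[0, β]`.
  have hG : ∀ β : Below κ, ∃ γ, ∀ l : List (Set.Iic β), F (l.map Subtype.val) < γ := by
    intro β
    refine exists_forall_lt hr (fun l : List (Set.Iic β) => F (l.map Subtype.val)) ?_
    have : Nonempty (Set.Iic β) := ⟨⟨β, Set.self_mem_Iic⟩⟩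
    rw [Cardinal.mk_list_eq_max_mk_aleph0]
    exact max_lt (mk_Iic_below hr β) (by simpa using hκ)
  choose G hG using hG
  refine ⟨_, isClub_diagInter hκ hr fun β => isClub_Ioi hr (G β), fun α hα ⟨β₀, hβ₀⟩ l hl => ?_⟩
  obtain ⟨β, hβα, hβ⟩ : ∃ β < α, ∀ x ∈ l, x ≤ β := by
    clear hG
    induction l with
    | nil => exact ⟨β₀, hβ₀, by simp⟩
    | cons a l ih =>
      obtain ⟨β, hβα, hβ⟩ := ih fun x hx => hl x (List.mem_cons_of_mem _ hx)
      refine ⟨max a β, max_lt (hl a List.mem_cons_self) hβα, fun x hx => ?_⟩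
      rcases List.mem_cons.1 hx with rfl | hx
      · exact le_max_left _ _
      · exact (hβ x hx).trans (le_max_right _ _)
  have h : (l.attach.map fun x => (⟨x.1, hβ x.1 x.2⟩ : Set.Iic β)).map Subtype.val = l := by
    rw [List.map_map]
    exact List.attach_map_subtype_val l
  rw [← h]
  exact (hG β _).trans (hα β hβα)

/-- A pair of bounded approximations which does not yet violate `E_S` below its length, and which
extends a given one. -/
structure PairApprox (S : Set (Below κ)) (p : Cantor κ) (δ₀ : Below κ) where
  /-- The first point; only its part below the length matters. -/
  left : Cantor κ
  /-- The second point; only its part below the length matters. -/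
  right : Cantor κ
  /-- The length of the approximation. -/
  len : Below κ
  le_len : δ₀ ≤ len
  left_mem : left ∈ basicOpen κ δ₀ p
  right_mem : right ∈ basicOpen κ δ₀ p
  const : ∀ s ∈ S, s ≤ len → EventuallyConstBelow s left right

theorem eventuallyConstBelow_of_const_from {δ s : Below κ} (hδ : δ < s) {η ξ : Cantor κ} {b : Bool}
    (h : ∀ γ, δ ≤ γ → symmDiffFun κ η ξ γ = b) : EventuallyConstBelow s η ξ :=
  ⟨δ, hδ, b, fun γ hγ => h γ hγ.1.le⟩

theorem PairApprox.eStar_of_extends {S : Set (Below κ)} {p : Cantor κ} {δ₀ : Below κ}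
    (x : PairApprox S p δ₀) {η ξ : Cantor κ} (hη : η ∈ basicOpen κ x.len x.left)
    (hξ : ξ ∈ basicOpen κ x.len x.right) {b : Bool}
    (h : ∀ γ, x.len ≤ γ → symmDiffFun κ η ξ γ = b) : EStar κ S η ξ := by
  intro s hs
  rcases le_or_gt s x.len with hle | hlt
  · exact (x.const s hs hle).congr (fun γ hγ => hη γ (hγ.trans_le hle))
      fun γ hγ => hξ γ (hγ.trans_le hle)
  · exact eventuallyConstBelow_of_const_from hlt h

/-- A map whose coordinates are locally constant on a comeager set `G` and which reduces `E_{S'}` to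
`E_S` on a basic open part of `G`. -/
structure GenericReduction (κ : Cardinal.{u}) (S' S : Set (Below κ)) (G : Set (Cantor κ))
    (p : Cantor κ) (δ₀ : Below κ) (g : Cantor κ → Cantor κ) : Prop where
  comeager : IsComeager κ G
  locallyConst : ∀ η ∈ G, ∀ γ, ∃ δ, ∀ ζ ∈ G, ζ ∈ basicOpen κ δ η → g ζ γ = g η γ
  reduces : ∀ η ∈ G, ∀ ξ ∈ G, η ∈ basicOpen κ δ₀ p → ξ ∈ basicOpen κ δ₀ p →
    (ES κ S' η ξ ↔ ES κ S (g η) (g ξ))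

namespace GenericReduction

variable {S' S : Set (Below κ)} {G : Set (Cantor κ)} {p : Cantor κ} {δ₀ : Below κ}
  {g : Cantor κ → Cantor κ}

theorem exists_agree (h : GenericReduction κ S' S G p δ₀ g) (hr : κ.IsRegular) {η : Cantor κ}
    (hη : η ∈ G) (α : Below κ) :
    ∃ δ, ∀ ζ ∈ G, ζ ∈ basicOpen κ δ η → ∀ γ < α, g ζ γ = g η γ := by
  choose δ hδ using h.locallyConst η hη
  obtain ⟨ε, hε⟩ := exists_forall_Iio_lt hr α δ
  exact ⟨ε, fun ζ hζ hζη γ hγ => hδ γ ζ hζ (basicOpen_anti (hε γ hγ).le η hζη)⟩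

theorem mem_of_extends {δ : Below κ} (hδ : δ₀ ≤ δ) {η η' : Cantor κ} (hη : η ∈ basicOpen κ δ₀ p)
    (hη' : η' ∈ basicOpen κ δ η) : η' ∈ basicOpen κ δ₀ p := by
  intro γ hγ
  rw [hη' γ (hγ.trans_le hδ), hη γ hγ]

/-- If the approximation is extended by a pair with constant symmetric difference `b`, then the
images have symmetric difference `b` at some large coordinate. -/
theorem exists_image_eq (h : GenericReduction κ S' S G p δ₀ g) (hr : κ.IsRegular)
    (x : PairApprox S' p δ₀) (τ : Below κ) (b : Bool) {η ξ : Cantor κ} (hηG : η ∈ G) (hξG : ξ ∈ G)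
    (hη : η ∈ basicOpen κ x.len x.left) (hξ : ξ ∈ basicOpen κ x.len x.right)
    (hb : ∀ γ, x.len ≤ γ → symmDiffFun κ η ξ γ = b) :
    ∃ γ, τ ≤ γ ∧ symmDiffFun κ (g η) (g ξ) γ = b := by
  have hηp := mem_of_extends x.le_len x.left_mem hη
  have hξp := mem_of_extends x.le_len x.right_mem hξ
  have hE := x.eStar_of_extends hη hξ hb
  cases b with
  | false =>
    have h0 : ES κ S' η ξ := ⟨hE, e0_iff.2 ⟨x.len, fun γ hγ => symmDiffFun_eq_false.1 (hb γ hγ)⟩⟩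
    obtain ⟨B, hB⟩ := e0_iff.1 ((h.reduces η hηG ξ hξG hηp hξp).1 h0).2
    exact ⟨max τ B, le_max_left _ _, symmDiffFun_eq_false.2 (hB _ (le_max_right _ _))⟩
  | true =>
    -- If the images agreed from `τ` on, they would be inequivalent only through a violation at some
    -- `s` in `S`. That violation depends on bounded parts of `η` and `ξ`, and survives when these
    -- are continued by equal tails to an `E_{S'}`-equivalent pair, a contradiction.
    by_contra! hc
    have hc' : ∀ γ, τ ≤ γ → g η γ = g ξ γ := fun γ hγ =>
      symmDiffFun_eq_false.1 (by simpa using hc γ hγ)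
    have hnot : ¬ ES κ S' η ξ := by
      rintro ⟨-, h0⟩
      obtain ⟨B, hB⟩ := e0_iff.1 h0
      have h₁ := hb (max x.len B) (le_max_left _ _)
      have h₂ := symmDiffFun_eq_false.2 (hB (max x.len B) (le_max_right _ _))
      rw [h₁] at h₂
      exact absurd h₂ (by simp)
    rw [h.reduces η hηG ξ hξG hηp hξp] at hnot
    have : ¬ EStar κ S (g η) (g ξ) := fun hs => hnot ⟨hs, e0_iff.2 ⟨τ, hc'⟩⟩
    rw [eStar_iff] at this
    push Not at this
    obtain ⟨s, hs, hns⟩ := this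
    obtain ⟨δ₁, hδ₁⟩ := h.exists_agree hr hηG s
    obtain ⟨δ₂, hδ₂⟩ := h.exists_agree hr hξG s
    set δ := max x.len (max δ₁ δ₂) with hδ
    have hδx : x.len ≤ δ := le_max_left _ _
    have h1δ : δ₁ ≤ δ := (le_max_left _ _).trans (le_max_right _ _)
    have h2δ : δ₂ ≤ δ := (le_max_right _ _).trans (le_max_right _ _)
    obtain ⟨η', hη'G, ξ', hξ'G, hη', hξ', hconst⟩ := h.comeager.exists_pair hr η ξ δ false
    have hE' : EStar κ S' η' ξ' := by
      intro t ht
      rcases le_or_gt t δ with hle | hlt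
      · exact EventuallyConstBelow.congr (hE t ht) (fun γ hγ => hη' γ (hγ.trans_le hle))
          fun γ hγ => hξ' γ (hγ.trans_le hle)
      · exact eventuallyConstBelow_of_const_from hlt hconst
    have hES := (h.reduces η' hη'G ξ' hξ'G (mem_of_extends (x.le_len.trans hδx) hηp hη')
      (mem_of_extends (x.le_len.trans hδx) hξp hξ')).1
      ⟨hE', e0_iff.2 ⟨δ, fun γ hγ => symmDiffFun_eq_false.1 (hconst γ hγ)⟩⟩
    refine hns (EventuallyConstBelow.congr (hES.1 s hs) (fun γ hγ => ?_) fun γ hγ => ?_)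
    · exact (hδ₁ η' hη'G (basicOpen_anti h1δ η hη') γ hγ).symm
    · exact (hδ₂ ξ' hξ'G (basicOpen_anti h2δ ξ hξ') γ hγ).symm

/-- A constant tail `b` yields a late coordinate where the images have difference `b`; local
constancy on `G` makes a bounded part of the pair decide this, and the new length is taken beyond
that part. -/
theorem exists_step (h : GenericReduction κ S' S G p δ₀ g) (hr : κ.IsRegular)
    (x : PairApprox S' p δ₀) (τ : Below κ) (b : Bool) :
    ∃ y : PairApprox S' p δ₀, τ < y.len ∧ x.len < y.len ∧ y.left ∈ basicOpen κ x.len x.left ∧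
      y.right ∈ basicOpen κ x.len x.right ∧ ∃ γ, x.len ≤ γ ∧ γ < y.len ∧
        ∀ η ∈ G, ∀ ξ ∈ G, η ∈ basicOpen κ y.len y.left → ξ ∈ basicOpen κ y.len y.right →
          symmDiffFun κ (g η) (g ξ) γ = b := by
  have := noMaxOrder_below hr
  obtain ⟨η, hηG, ξ, hξG, hη, hξ, hb⟩ := h.comeager.exists_pair hr x.left x.right x.len b
  obtain ⟨γ, hγ, hγb⟩ := h.exists_image_eq hr x x.len b hηG hξG hη hξ hb
  obtain ⟨δ₁, hδ₁⟩ := h.locallyConst η hηG γ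
  obtain ⟨δ₂, hδ₂⟩ := h.locallyConst ξ hξG γ
  obtain ⟨δ, hδ⟩ := exists_gt (max (max γ τ) (max δ₁ δ₂))
  have h₁ : γ < δ := (le_max_left γ τ).trans_lt ((le_max_left _ _).trans_lt hδ)
  have h₂ : τ < δ := (le_max_right γ τ).trans_lt ((le_max_left _ _).trans_lt hδ)
  have h₃ : δ₁ ≤ δ := (le_max_left δ₁ δ₂).trans ((le_max_right _ _).trans hδ.le)
  have h₄ : δ₂ ≤ δ := (le_max_right δ₁ δ₂).trans ((le_max_right _ _).trans hδ.le)
  refine ⟨⟨η, ξ, δ, x.le_len.trans (hγ.trans h₁.le), mem_of_extends x.le_len x.left_mem hη,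
    mem_of_extends x.le_len x.right_mem hξ, fun s hs _ => x.eStar_of_extends hη hξ hb s hs⟩,
    h₂, hγ.trans_lt h₁, hη, hξ, γ, hγ, h₁, fun η' hη'G ξ' hξ'G hη' hξ' => ?_⟩
  rw [← hγb]
  simp only [symmDiffFun]
  rw [hδ₁ η' hη'G (basicOpen_anti h₃ η hη'), hδ₂ ξ' hξ'G (basicOpen_anti h₄ ξ hξ')]

theorem not_isStationary_diff (h : GenericReduction κ S' S G p δ₀ g) (hκ : ℵ₀ < κ)
    (hr : κ.IsRegular) (hS' : S' ⊆ cofOmega κ) (hS : S ⊆ cofOmega κ) :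
    ¬ IsStationary (S \ S') := by
  intro hst
  choose step hτ hlen hl hr' γ hγ hγlt hγb using h.exists_step hr
  let x₀ : PairApprox S' p δ₀ := ⟨p, p, δ₀, le_rfl, self_mem_basicOpen _ _, self_mem_basicOpen _ _,
    fun s hs _ => .of_eqOn (hS' hs) fun _ _ => rfl⟩
  -- Iterated steps along a list of length targets, the parity of the stage choosing the bit.
  -- Indexing by all finite lists gives a club of closure points before `α` and its ladder are
  -- known.
  let T : List (Below κ) → PairApprox S' p δ₀ := fun l =>
    l.rec x₀ fun τ l x => step x τ (decide (l.length % 2 = 1))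
  obtain ⟨C, hC, hCcl⟩ := exists_isClub_closed_list hκ hr fun l => (T l).len
  obtain ⟨α, ⟨hαS, hαS'⟩, hαC⟩ := hst hC
  obtain ⟨a, haα, ha⟩ := exists_seq_of_mem_cofOmega (hS hαS)
  let l : ℕ → List (Below κ) := fun n => n.rec [] fun n l => a n :: l
  have hllen : ∀ n, (l n).length = n := fun n => by
    induction n with
    | zero => rfl
    | succ n ih => exact congrArg (· + 1) ih
  have hlα : ∀ n, ∀ x ∈ l n, x < α := fun n => by
    induction n with
    | zero => intro x hx; exact absurd hx List.not_mem_nil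
    | succ n ih =>
      intro x hx
      rcases List.mem_cons.1 hx with rfl | hx
      · exact haα n
      · exact ih x hx
  let x : ℕ → PairApprox S' p δ₀ := fun n => T (l n)
  have hx : ∀ n, x (n + 1) = step (x n) (a n) (decide (n % 2 = 1)) := fun n => by
    change step (T (l n)) (a n) (decide ((l n).length % 2 = 1)) = _
    rw [hllen]
  have hxα : ∀ n, (x n).len < α := fun n => hCcl α hαC ⟨a 0, haα 0⟩ _ (hlα n)
  have hmono : StrictMono fun n => (x n).len := strictMono_nat_of_lt_succ fun n => by
    rw [hx]
    exact hlen _ _ _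
  have hcof : ∀ β < α, ∃ n, β < (x n).len := by
    intro β hβ
    obtain ⟨n, hn⟩ := ha β hβ
    refine ⟨n + 1, hn.trans ?_⟩
    rw [hx]
    exact hτ _ _ _
  have hcohl : ∀ n k, (x (n + k)).left ∈ basicOpen κ (x n).len (x n).left := by
    intro n k
    induction k with
    | zero => exact self_mem_basicOpen _ _
    | succ k ih =>
      intro β hβ
      rw [← ih β hβ, ← add_assoc, hx]
      exact hl _ _ _ β (hβ.trans_le (hmono.monotone (by omega)))
  have hcohr : ∀ n k, (x (n + k)).right ∈ basicOpen κ (x n).len (x n).right := by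
    intro n k
    induction k with
    | zero => exact self_mem_basicOpen _ _
    | succ k ih =>
      intro β hβ
      rw [← ih β hβ, ← add_assoc, hx]
      exact hr' _ _ _ β (hβ.trans_le (hmono.monotone (by omega)))
  choose! N hN using hcof
  -- The unions of the two chains; only their parts below `α` matter.
  let η₀ : Cantor κ := fun β => (x (N β)).left β
  let ξ₀ : Cantor κ := fun β => (x (N β)).right β
  have hη₀ : ∀ n, η₀ ∈ basicOpen κ (x n).len (x n).left := by
    intro n β hβ
    have hβN := hN β (hβ.trans (hxα n))
    rcases le_total n (N β) with hle | hle
    · obtain ⟨k, hk⟩ := Nat.exists_eq_add_of_le hle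
      change (x (N β)).left β = _
      rw [hk]
      exact hcohl n k β hβ
    · obtain ⟨k, hk⟩ := Nat.exists_eq_add_of_le hle
      rw [hk]
      exact (hcohl (N β) k β hβN).symm
  have hξ₀ : ∀ n, ξ₀ ∈ basicOpen κ (x n).len (x n).right := by
    intro n β hβ
    have hβN := hN β (hβ.trans (hxα n))
    rcases le_total n (N β) with hle | hle
    · obtain ⟨k, hk⟩ := Nat.exists_eq_add_of_le hle
      change (x (N β)).right β = _
      rw [hk]
      exact hcohr n k β hβ
    · obtain ⟨k, hk⟩ := Nat.exists_eq_add_of_le hle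
      rw [hk]
      exact (hcohr (N β) k β hβN).symm
  obtain ⟨η, hηG, ξ, hξG, hη, hξ, hconst⟩ := h.comeager.exists_pair hr η₀ ξ₀ α false
  have hηx : ∀ n, η ∈ basicOpen κ (x n).len (x n).left := fun n β hβ => by
    rw [hη β (hβ.trans (hxα n)), hη₀ n β hβ]
  have hξx : ∀ n, ξ ∈ basicOpen κ (x n).len (x n).right := fun n β hβ => by
    rw [hξ β (hβ.trans (hxα n)), hξ₀ n β hβ]
  have hES' : ES κ S' η ξ := by
    refine ⟨fun s hs => ?_, e0_iff.2 ⟨α, fun β hβ => symmDiffFun_eq_false.1 (hconst β hβ)⟩⟩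
    rcases lt_trichotomy s α with hlt | rfl | hgt
    · have hsN := hN s hlt
      exact ((x (N s)).const s hs hsN.le).congr (fun β hβ => hηx _ β (hβ.trans hsN))
        fun β hβ => hξx _ β (hβ.trans hsN)
    -- The only level where the oscillating difference could violate `E_{S'}`.
    · exact absurd hs hαS'
    · exact eventuallyConstBelow_of_const_from hgt hconst
  have hES := (h.reduces η hηG ξ hξG
    (mem_of_extends (x 0).le_len (x 0).left_mem (hηx 0))
    (mem_of_extends (x 0).le_len (x 0).right_mem (hξx 0))).1 hES'
  obtain ⟨β, hβ, b, hb⟩ := hES.1 α hαS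
  -- The coordinate chosen at stage `n` lies in `(β, α)`, so every late stage would have the same
  -- parity.
  have hval : ∀ n, β < (x n).len → decide (n % 2 = 1) = b := by
    intro n hn
    have h₁ := hγ (x n) (a n) (decide (n % 2 = 1))
    have h₂ := hγlt (x n) (a n) (decide (n % 2 = 1))
    have h₃ := hγb (x n) (a n) (decide (n % 2 = 1)) η hηG ξ hξG
    rw [← hx n] at h₂ h₃
    rw [← h₃ (hηx (n + 1)) (hξx (n + 1))]
    exact hb _ ⟨hn.trans_le h₁, h₂.trans (hxα (n + 1))⟩
  have h₁ := hval _ (hN β hβ)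
  have h₂ := hval (N β + 1) ((hN β hβ).trans (hmono (Nat.lt_succ_self _)))
  rw [← h₂, decide_eq_decide] at h₁
  omega

end GenericReduction

/-- On a comeager set the reduction has locally constant coordinates and locally constant copy; near
one of its points it thus reduces `E_{S'}` to a single `E_{S k}`. -/
theorem not_borelReducible_directSum (hκ : ℵ₀ < κ) (hr : κ.IsRegular) {m : Ordinal.{u}}
    (e : Set.Iio m ↪ Below κ) {S : Ordinal.{u} → Set (Below κ)} (hS : ∀ k < m, S k ⊆ cofOmega κ)
    {S' : Set (Below κ)} (hS' : S' ⊆ cofOmega κ) (hst : ∀ k < m, IsStationary (S k \ S')) :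
    ¬ BorelReducible κ (ES κ S') (directSum κ m fun k => ES κ (S k)) := by
  rintro ⟨f, hf, hfE⟩
  have h₁ : ∀ k : Set.Iio m, ∃ G, IsComeager κ G ∧ DecidedOn κ G {η | (f η).1 = k} := fun k =>
    (hf _ (isOpen_sigma_fst k)).exists_decidedOn hr
  have h₂ : ∀ γ, ∃ G, IsComeager κ G ∧ DecidedOn κ G {η | (f η).2 γ = true} := fun γ =>
    (hf _ (isOpen_sigma_coord hr γ true)).exists_decidedOn hr
  choose G₁ hG₁ hG₁f using h₁
  choose G₂ hG₂ hG₂f using h₂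
  let G := (⋂ k, G₁ k) ∩ ⋂ γ, G₂ γ
  have hG : IsComeager κ G := (IsComeager.iInter hr e hG₁).inter hr (.iInter hr (.refl _) hG₂)
  obtain ⟨a⟩ := nonempty_below hr
  obtain ⟨p, hp, -⟩ := hG.exists_mem hr (fun _ => false) a
  obtain ⟨δ₀, hδ₀⟩ := (hG₁f (f p).1).mono (H := G)
    (Set.inter_subset_left.trans (Set.iInter_subset _ _)) p hp
  have hk : ∀ η ∈ G, η ∈ basicOpen κ δ₀ p → (f η).1 = (f p).1 := fun η hη hηp =>
    (hδ₀ η hη hηp).2 rfl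
  have : GenericReduction κ S' (S (f p).1) G p δ₀ fun η => (f η).2 := by
    refine ⟨hG, fun η hη γ => ?_, fun η hη ξ hξ hηp hξp => ?_⟩
    · obtain ⟨δ, hδ⟩ := (hG₂f γ).mono (H := G)
        (Set.inter_subset_right.trans (Set.iInter_subset _ _)) η hη
      exact ⟨δ, fun ζ hζ hζη => Bool.eq_iff_iff.2 (hδ ζ hζ hζη)⟩
    · rw [hfE, directSum, hk η hη hηp, hk ξ hξ hξp]
      simp
  exact this.not_isStationary_diff hκ hr hS' (hS _ (f p).1.2) (hst _ (f p).1.2)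

/-! ### Comparing the sums -/

theorem directSum_reducible_of_le {m n : Ordinal.{u}} (h : m ≤ n)
    (E : Ordinal.{u} → Cantor κ → Cantor κ → Prop) :
    BorelReducible κ (directSum κ m E) (directSum κ n E) := by
  let c : Set.Iio m → Set.Iio n := fun k => ⟨k.1, lt_of_lt_of_le (Set.mem_Iio.1 k.2) h⟩
  refine ⟨fun x => ⟨c x.1, x.2⟩, .of_continuous (continuous_sigma fun k =>
    continuous_sigmaMk (σ := fun _ : Set.Iio n => Cantor κ) (i := c k)), fun x y => ?_⟩
  refine and_congr_left fun _ => ?_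
  simp [c, Subtype.ext_iff]

theorem reducible_directSum {m k : Ordinal.{u}} (hk : k < m)
    (E : Ordinal.{u} → Cantor κ → Cantor κ → Prop) :
    BorelReducible κ (E k) (directSum κ m E) := by
  refine ⟨fun x => ⟨⟨k, hk⟩, x⟩, .of_continuous
    (continuous_sigmaMk (σ := fun _ : Set.Iio m => Cantor κ) (i := ⟨k, hk⟩)), fun x y => ?_⟩
  simp [directSum]

theorem one_add_lt_ord_succ (hκ : ℵ₀ ≤ κ) {i : Ordinal.{u}} (hi : i < (Order.succ κ).ord) :
    1 + i < (Order.succ κ).ord := by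
  rw [Cardinal.lt_ord] at hi ⊢
  rw [Ordinal.card_add, Ordinal.card_one]
  have h := hκ.trans (Order.le_succ κ)
  exact Cardinal.add_lt_of_lt h (Cardinal.one_lt_aleph0.trans_le h) hi

theorem nonempty_Iio_embedding {m : Ordinal.{u}} (hm : m < (Order.succ κ).ord) :
    Nonempty (Set.Iio m ↪ Below κ) := by
  rw [← Cardinal.le_def, Cardinal.mk_Iio_ordinal, mk_below, Cardinal.lift_le]
  exact Order.lt_succ_iff.1 (Cardinal.lt_ord.1 hm)

end GenCantor

/-! ### The strictly increasing chain below `E₀` -/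

open GenCantor in
theorem theorem33 (κ : Cardinal.{u}) (hκ : Cardinal.aleph0 < κ)
    (hpow : Cardinal.powerlt κ κ = κ) :
    ∃ (S : Ordinal.{u} → Set (GenCantor.Below κ))
      (R : Ordinal.{u} → GenCantor.Cantor κ → GenCantor.Cantor κ → Prop),
      -- the `S i` are stationary sets of `ω`-cofinal ordinals, with stationary differences
      (∀ i < (Order.succ κ).ord, S i ⊆ GenCantor.cofOmega κ ∧ IsStationary (S i)) ∧
      (∀ i < (Order.succ κ).ord, ∀ j < (Order.succ κ).ord, i ≠ j → IsStationary (S i \ S j)) ∧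
      -- the `R i` are Borel equivalence relations on `2^κ`
      (∀ i < (Order.succ κ).ord, GenCantor.IsBorelEquivalence κ (R i)) ∧
      -- `R i` is the disjoint union of the `E_{S j}` for `j < 1 + i`, carried over to `2^κ`
      (∀ i < (Order.succ κ).ord, GenCantor.BorelIsomorphic κ (R i)
        (GenCantor.directSum κ (1 + i) fun j => GenCantor.ES κ (S j))) ∧
      -- they form a strictly increasing chain
      (∀ i < (Order.succ κ).ord, ∀ j < (Order.succ κ).ord,
        (i < j ↔ GenCantor.StrictlyBorelReducible κ (R i) (R j))) ∧
      -- all of them are below `E₀`, and none is above it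
      (∀ i < (Order.succ κ).ord, GenCantor.BorelReducible κ (R i) (GenCantor.E0 κ) ∧
        ¬ GenCantor.BorelReducible κ (GenCantor.E0 κ) (R i)) := by
  have hr := isRegular_of_powerlt hκ.le hpow
  obtain ⟨S, hS, hdiff⟩ := exists_isStationary_diff_family hκ hr
  have hSω : ∀ m, ∀ k < m, S k ⊆ cofOmega κ := fun _ k _ => (hS k).1
  let D := fun m : Ordinal.{u} => directSum κ m fun k => ES κ (S k)
  have hlt : ∀ {i}, i < (Order.succ κ).ord → 1 + i < (Order.succ κ).ord := fun hi =>
    one_add_lt_ord_succ hκ.le hi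
  have hR : ∀ i, ∃ R : Cantor κ → Cantor κ → Prop, i < (Order.succ κ).ord →
      IsBorelEquivalence κ R ∧ BorelIsomorphic κ R (D (1 + i)) := by
    intro i
    by_cases hi : i < (Order.succ κ).ord
    · obtain ⟨e⟩ := nonempty_Iio_embedding (hlt hi)
      obtain ⟨φ, hφ, hφ'⟩ := exists_borel_equiv_sigma hr (m := 1 + i) (zero_lt_one.trans_le le_self_add) e
      refine ⟨fun x y => D (1 + i) (φ x) (φ y), fun _ => ⟨⟨?_, isKBorel_directSum hr e S hφ⟩,
        φ, hφ, hφ', fun _ _ => Iff.rfl⟩⟩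
      exact (equivalence_directSum fun k _ => equivalence_ES hr (hS k).1).comap φ
    · exact ⟨fun _ _ => True, fun h => absurd h hi⟩
  choose R hR using hR
  have hle : ∀ i < (Order.succ κ).ord, ∀ j < (Order.succ κ).ord, i ≤ j →
      BorelReducible κ (R i) (R j) := fun i hi j hj hij =>
    ((hR i hi).2.borelReducible.trans (directSum_reducible_of_le (by gcongr) _)).trans
      (hR j hj).2.borelReducible_symm
  have hnot : ∀ i < (Order.succ κ).ord, ∀ j < (Order.succ κ).ord, i < j →
      ¬ BorelReducible κ (R j) (R i) := by
    intro i hi j hj hij h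
    obtain ⟨e⟩ := nonempty_Iio_embedding (hlt hi)
    have hlt' : 1 + i < 1 + j := by gcongr
    -- The summand with index `1 + i` occurs in the larger sum but not in the smaller, whose indices
    -- are all different from it.
    refine not_borelReducible_directSum hκ hr e (hSω _) (hS (1 + i)).1 (fun k hk => ?_)
      ((((reducible_directSum hlt' _).trans (hR j hj).2.borelReducible_symm).trans h).trans
        (hR i hi).2.borelReducible)
    exact hdiff k (hk.trans (hlt hi)) _ (hlt hi) hk.ne
  refine ⟨S, R, fun i _ => hS i, hdiff, fun i hi => (hR i hi).1, fun i hi => (hR i hi).2,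
    fun i hi j hj => ⟨fun hij => ⟨hle i hi j hj hij.le, hnot i hi j hj hij⟩, fun h => ?_⟩,
    fun i hi => ?_⟩
  · exact lt_of_not_ge fun hji => h.2 (hle j hj i hi hji)
  · obtain ⟨e⟩ := nonempty_Iio_embedding (hlt hi)
    refine ⟨(hR i hi).2.borelReducible.trans (borelReducible_directSum_E0 hr hpow e (hSω _)),
      fun h => ?_⟩
    have h0 : BorelReducible κ (ES κ ∅) (E0 κ) :=
      ⟨id, .of_continuous continuous_id, fun _ _ => eS_empty_iff⟩
    refine not_borelReducible_directSum hκ hr e (hSω _) (Set.empty_subset _) (fun k _ => ?_)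
      ((h0.trans h).trans (hR i hi).2.borelReducible)
    simpa using (hS k).2
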